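/- Setting. Let $D\subset\mathbb R^p$ be non-empty, $\nu$ a $\sigma$-finite measure on $D$, and let $T:D\to\mathbb R^{q\times q}$ and $\xi:D\to\mathbb R$ be measurable. With $\langle A,B\rangle_{\mathrm{tr}}=\operatorname{tr}(A^\top B)$ put $$\gamma(M)=\log\int_D e^{-\langle M,T(x)\rangle_{\mathrm{tr}}+\xi(x)}\,d\nu(x),\qquad f_M(x)=e^{-\langle M,T(x)\rangle_{\mathrm{tr}}+\xi(x)-\gamma(M)},$$ and $\mathfrak M^*=\operatorname{interior}\{M\in\mathbb R^{q\times q}:\gamma(M)<\infty\}$. Let $\mathfrak M\subset\mathfrak M^*$ be convex and open relative to an affine subspace $L$ of $\mathbb R^{q\times q}$ with direction space $V$, and suppose that $M\mapsto f_M$ is one-to-one on $\mathfrak M$ (densities that agree $\nu$-almost everywhere being identified). Let $M\in\mathfrak M$, let $X^1,X^2,\dots$ be i.i.d. with density $f_M$ with respect to $\nu$, and put $\bar T_n=\frac1n\sum_{i=1}^nT(X^i)$. The maximum likelihood estimator is $$\hat M_n=\operatorname*{argmin}_{M'\in\mathfrak M}\big\{\langle M',\bar T_n\rangle_{\mathrm{tr}}+\gamma(M')\big\}.$$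 More precisely, $\hat M_n$ is any random matrix (measurable) that, almost surely, is a minimizer whenever a minimizer exists, with arbitrary value otherwise. The Fisher information at $M$ is the bilinear form $I_M(A,B)=\mathbb E_M[\partial_A\log f_M(X)\,\partial_B\log f_M(X)]$, where $\partial_A$ is the derivative with respect to $M$ in direction $A$. Theorem. Almost surely, for all sufficiently large $n$ the minimizer exists and is unique. The form $I_M$ is positive definite on $V$, and $$\sqrt n\,(\hat M_n-M)\ \longrightarrow\ \mathcal N(0,I_M^{-1})\quad\text{in distribution as }n\to\infty .$$ Here $\mathbb R^{q\times q}$ is identified with $\mathbb R^{q^2}$ and $I_M^{-1}$ is the inverse of $I_M$ along $V$: for any basis $b_1,\dots,b_d$ of $V$ and $J=(I_M(b_k,b_l))_{k,l}$, $$(I_M^{-1})_{ij\,i'j'}=\sum_{k,l=1}^d(J^{-1})_{kl}\,(b_k)_{ij}\,(b_l)_{i'j'},$$ which is the ordinary matrix inverse of $I_M$ if $V=\mathbb R^{q\times q}$. -/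

import Mathlib

open MeasureTheory ProbabilityTheory Filter Topology Matrix
open scoped ENNReal

noncomputable section

namespace ExpTrace

/-- The trace (Frobenius) inner product `⟨A, B⟩_tr = tr (Aᵀ B)`. -/
def traceInner {q : ℕ} (A B : Matrix (Fin q) (Fin q) ℝ) : ℝ :=
  (Aᵀ * B).trace

/-- The vectorization `ℝ^{q × q} ≃ ℝ^{q²}`. -/
def vectorize {q : ℕ} (A : Matrix (Fin q) (Fin q) ℝ) : EuclideanSpace ℝ (Fin q × Fin q) :=
  WithLp.toLp 2 (fun ij => A ij.1 ij.2)

/-- The specification `(D, ν, T, ξ)` of an exponential trace model: a non-empty domain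
`D ⊆ ℝ^p`, a `σ`-finite measure `ν` on `D`, and measurable data functions
`T : D → ℝ^{q × q}`, `ξ : D → ℝ`. -/
structure TraceModel (p q : ℕ) where
  /-- the domain -/
  D : Set (Fin p → ℝ)
  nonempty : D.Nonempty
  /-- the base measure -/
  ν : Measure D
  sigmaFinite : SigmaFinite ν
  /-- the matrix-valued data function -/
  T : D → Matrix (Fin q) (Fin q) ℝ
  measurable_T : ∀ i j, Measurable fun x => T x i j
  /-- the additional data term -/
  ξ : D → ℝ
  measurable_ξ : Measurable ξ

namespace TraceModel

variable {p q : ℕ} (E : TraceModel p q)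

/-- `∫_D exp (-⟨M, T x⟩_tr + ξ x) dν ∈ [0, ∞]`, that is, `exp (γ M)`. -/
def partition (M : Matrix (Fin q) (Fin q) ℝ) : ℝ≥0∞ :=
  ∫⁻ x, ENNReal.ofReal (Real.exp (-traceInner M (E.T x) + E.ξ x)) ∂E.ν

/-- The log-normalization `γ M` (used only where `E.partition M` is finite). -/
def γ (M : Matrix (Fin q) (Fin q) ℝ) : ℝ :=
  Real.log (E.partition M).toReal

/-- `𝔐* = interior {M : γ M < ∞}`. -/
def naturalParameters : Set (Matrix (Fin q) (Fin q) ℝ) :=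
  interior {M | E.partition M < ∞}

/-- The density `f_M x = exp (-⟨M, T x⟩_tr + ξ x - γ M)` with respect to `ν`. -/
def density (M : Matrix (Fin q) (Fin q) ℝ) (x : E.D) : ℝ :=
  Real.exp (-traceInner M (E.T x) + E.ξ x - E.γ M)

/-- The distribution on `D` that has density `f_M` with respect to `ν`. -/
def law (M : Matrix (Fin q) (Fin q) ℝ) : Measure E.D :=
  E.ν.withDensity fun x => ENNReal.ofReal (E.density M x)

/-- The standing assumptions on the parameter space `𝔐`: it is a convex subset of `𝔐*`, it is open
relative to the affine subspace `L`, and `M ↦ f_M` is one-to-one on `𝔐`, where densities with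
respect to `ν` are identified if they agree `ν`-almost everywhere. -/
structure IsParameterSpace (L : AffineSubspace ℝ (Matrix (Fin q) (Fin q) ℝ))
    (𝔐 : Set (Matrix (Fin q) (Fin q) ℝ)) : Prop where
  subset : 𝔐 ⊆ E.naturalParameters
  convex : Convex ℝ 𝔐
  relOpen : ∃ U : Set (Matrix (Fin q) (Fin q) ℝ), IsOpen U ∧ 𝔐 = U ∩ L
  injective : ∀ M ∈ 𝔐, ∀ N ∈ 𝔐, E.density M =ᵐ[E.ν] E.density N → M = N

/-- The generalized Gram matrix `T̄ = n⁻¹ ∑ T(xⁱ)`. -/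
def gram {n : ℕ} (x : Fin n → E.D) : Matrix (Fin q) (Fin q) ℝ :=
  (n : ℝ)⁻¹ • ∑ i, E.T (x i)

/-- `N` is a minimizer over `𝔐` of `M ↦ ⟨M, T̄⟩_tr + γ M`, i.e. a maximum likelihood estimate for
the data `x`. -/
def IsMLE (𝔐 : Set (Matrix (Fin q) (Fin q) ℝ)) {n : ℕ} (x : Fin n → E.D)
    (N : Matrix (Fin q) (Fin q) ℝ) : Prop :=
  N ∈ 𝔐 ∧ IsMinOn (fun M => traceInner M (E.gram x) + E.γ M) 𝔐 N

/-- The score at `M` in direction `A`: the directional derivative of `M ↦ log f_M x`. -/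
def score (M A : Matrix (Fin q) (Fin q) ℝ) (x : E.D) : ℝ :=
  lineDeriv ℝ (fun M' => Real.log (E.density M' x)) M A

/-- The Fisher information (of one observation) at `M`, acting on pairs of matrices. -/
def fisher (M A B : Matrix (Fin q) (Fin q) ℝ) : ℝ :=
  ∫ x, E.score M A x * E.score M B x ∂E.law M

/-- The Fisher information matrix at `M` in the coordinates `θ ↦ M + ∑ₖ θₖ bₖ`. -/
def fisherMatrix (M : Matrix (Fin q) (Fin q) ℝ) {d : ℕ} (b : Fin d → Matrix (Fin q) (Fin q) ℝ) :
    Matrix (Fin d) (Fin d) ℝ :=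
  Matrix.of fun k l => E.fisher M (b k) (b l)

/-- The inverse Fisher information as a (vectorized) tensor on `ℝ^{q × q}`: the inverse of the
Fisher information matrix in the coordinates given by `b`, transported back by `b`, i.e.
`∑ₖₗ (J⁻¹)ₖₗ (bₖ ⊗ bₗ)` with `J = fisherMatrix M b`. For `b` the standard basis of `ℝ^{q × q}` this
is the plain inverse of the `q² × q²` matrix of the Fisher information. -/
def fisherInverse (M : Matrix (Fin q) (Fin q) ℝ) {d : ℕ} (b : Fin d → Matrix (Fin q) (Fin q) ℝ) :
    Matrix (Fin q × Fin q) (Fin q × Fin q) ℝ :=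
  Matrix.of fun ij i'j' =>
    ∑ k, ∑ l, (E.fisherMatrix M b)⁻¹ k l * b k ij.1 ij.2 * b l i'j'.1 i'j'.2

end TraceModel

end ExpTrace

end

/-! Write the parameters as M + C h, where C maps onto the direction space V and turns the Fisher
information at M into the identity, and let Y be the statistic ⟨C ·, T⟩ centred under f_M. Up to a
constant the negative log-likelihood is ⟨h, u⟩ + ψ(h), where u is the sample mean of Y and ψ(h) =
log E exp(-⟨h, Y⟩) = |h|²/2 + O(|h|³).

The data enter only through the linear term, so the core is deterministic: for small u the minimizer
exists, is unique and equals -u + o(|u|) (`existsUnique_isMinOn_linear_perturbation`). Existence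
comes from comparing values on a small sphere around -u with the value at -u. Uniqueness holds
because exp(⟨h, u⟩ + ψ(h)) = E exp⟨h, u - Y⟩ is strictly convex by identifiability; the exponential
is monotone, so it keeps the minimizers.

The law of large numbers makes u small almost surely. The central limit theorem sends √n u to a
standard Gaussian G, and the delta method gives the limit -C G of √n times the error of the
estimator. Its covariance C Cᵀ is the inverse Fisher information along V.

The whitening map C exists because I_M(A, A) is the variance of ⟨A, T⟩: if it vanished for some A ≠
0 in V, then M and M + tA would have the same density for small t. -/

/-! ### Minimizers of linearly perturbed convex functions -/

section Argmin

open Metric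

variable {W : Type*} [NormedAddCommGroup W] [InnerProductSpace ℝ W] [FiniteDimensional ℝ W]

/-- If a function that is convex on an open set is larger on a sphere than at its centre, then it
has a minimizer inside the sphere. -/
theorem ConvexOn.exists_isMinOn_mem_ball {K : Set W} (hK : IsOpen K) {f : W → ℝ}
    (hf : ConvexOn ℝ K f) {c : W} {s : ℝ} (hs : 0 < s) (hball : closedBall c s ⊆ K)
    (hsphere : ∀ h ∈ sphere c s, f c < f h) : ∃ h ∈ ball c s, IsMinOn f K h := by
  have hcont : ContinuousOn f (closedBall c s) := (hf.continuousOn hK).mono hball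
  obtain ⟨h, hh, hmin⟩ := (isCompact_closedBall c s).exists_isMinOn
    ⟨c, mem_closedBall_self hs.le⟩ hcont
  have hlt : h ∈ ball c s := by
    rw [mem_closedBall] at hh
    rw [mem_ball]
    refine lt_of_le_of_ne hh fun heq => ?_
    exact absurd (hmin (mem_closedBall_self hs.le)) (not_le.2 (hsphere h heq))
  refine ⟨h, hlt, IsMinOn.of_isLocalMinOn_of_convexOn (hball hh) ?_ hf⟩
  refine IsLocalMin.on ?_ K
  filter_upwards [isOpen_ball.mem_nhds hlt] with z hz using hmin (ball_subset_closedBall hz)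

/-- Linear perturbations of a function `ψ` with expansion `‖h‖² / 2 + O(‖h‖³)` at `0` have a
minimizer close to that of the quadratic approximation. -/
theorem exists_isMinOn_linear_perturbation {K : Set W} (hK : IsOpen K) (h0 : 0 ∈ K) {ψ : W → ℝ}
    (hconv : ∀ u, ConvexOn ℝ K fun h => Real.exp (inner ℝ h u + ψ h)) {A r : ℝ} (hr : 0 < r)
    (hψ : ∀ h, ‖h‖ ≤ r → |ψ h - ‖h‖ ^ 2 / 2| ≤ A * ‖h‖ ^ 3) {ρ : ℝ} (hρ : 0 < ρ) :
    ∃ s₀ > 0, ∀ s, 0 < s → s ≤ s₀ → ∀ u : W, ‖u‖ ≤ ρ⁻¹ * s →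
      ∃ h ∈ ball (-u) s, h ∈ K ∧ IsMinOn (fun h => inner ℝ h u + ψ h) K h := by
  obtain ⟨r', hr', hrK⟩ := Metric.isOpen_iff.1 hK 0 h0
  -- On the ball of radius s around -u, ‖h‖ ≤ s + ‖u‖ ≤ κ s, so the cubic error is at most A' s³.
  set κ := 1 + ρ⁻¹ with hκ
  have hρi : 0 < ρ⁻¹ := inv_pos.2 hρ
  have hκ0 : 0 < κ := by positivity
  set A' := |A| * κ ^ 3 + 1 with hA'
  have hA'0 : 0 < A' := by positivity
  -- The three bounds keep the ball where the expansion holds, keep it inside `K`, and make the two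
  -- cubic errors (sphere and centre) at most s²/4 together, below the quadratic gain s²/2.
  refine ⟨min (min (r / κ) (r' / (2 * κ))) (1 / (8 * A')), by positivity, ?_⟩
  intro s hs hs0 u hu
  have hs1 : s * κ ≤ r :=
    (le_div_iff₀ hκ0).1 (hs0.trans ((min_le_left _ _).trans (min_le_left _ _)))
  have hs2 : s * (2 * κ) ≤ r' :=
    (le_div_iff₀ (by positivity)).1 (hs0.trans ((min_le_left _ _).trans (min_le_right _ _)))
  have hs3 : s * (8 * A') ≤ 1 :=
    (le_div_iff₀ (by positivity)).1 (hs0.trans (min_le_right _ _))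
  have hnorm : ∀ h ∈ closedBall (-u) s, ‖h‖ ≤ κ * s := by
    intro h hh
    rw [mem_closedBall, dist_eq_norm, sub_neg_eq_add] at hh
    calc ‖h‖ = ‖(h + u) - u‖ := by simp
      _ ≤ ‖h + u‖ + ‖u‖ := norm_sub_le _ _
      _ ≤ κ * s := by rw [hκ]; linarith
  have hball : closedBall (-u) s ⊆ K := by
    intro h hh
    refine hrK ?_
    rw [mem_ball_zero_iff]
    have := hnorm h hh
    nlinarith [mul_pos hκ0 hs]
  have herr : ∀ h ∈ closedBall (-u) s, |ψ h - ‖h‖ ^ 2 / 2| ≤ A' * s ^ 3 := by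
    intro h hh
    have h1 := hnorm h hh
    calc |ψ h - ‖h‖ ^ 2 / 2| ≤ A * ‖h‖ ^ 3 := hψ h (h1.trans (by linarith))
      _ ≤ |A| * (κ * s) ^ 3 := by gcongr; exact le_abs_self A
      _ ≤ A' * s ^ 3 := by rw [hA']; nlinarith [pow_pos hs 3]
  have hsq : ∀ h : W, inner ℝ h u + ‖h‖ ^ 2 / 2 = ‖h + u‖ ^ 2 / 2 - ‖u‖ ^ 2 / 2 := by
    intro h
    rw [norm_add_sq_real]; ring
  have hcentre : inner ℝ (-u) u + ψ (-u) ≤ - (‖u‖ ^ 2 / 2) + A' * s ^ 3 := by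
    have h1 := (abs_le.1 (herr (-u) (mem_closedBall_self hs.le))).2
    have h2 := hsq (-u)
    simp only [neg_add_cancel, norm_zero] at h2
    linarith
  obtain ⟨h, hh, hmin⟩ := (hconv u).exists_isMinOn_mem_ball hK hs hball (by
    intro h hh
    rw [Real.exp_lt_exp]
    have h1 := (abs_le.1 (herr h (sphere_subset_closedBall hh))).1
    have h2 := hsq h
    rw [mem_sphere, dist_eq_norm, sub_neg_eq_add] at hh
    rw [hh] at h2
    have h3 : 0 < s ^ 2 := by positivity
    have h4 : A' * s ^ 3 * 8 ≤ s ^ 2 := by nlinarith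
    linarith)
  exact ⟨h, hh, hball (ball_subset_closedBall hh), fun z hz => Real.exp_le_exp.1 (hmin hz)⟩

/-- The minimizer of `⟪h, u⟫ + ψ h` is unique and has derivative `-id` in `u = 0`. -/
theorem existsUnique_isMinOn_linear_perturbation {K : Set W} (hK : IsOpen K) (h0 : 0 ∈ K)
    {ψ : W → ℝ} (hconv : ∀ u, StrictConvexOn ℝ K fun h => Real.exp (inner ℝ h u + ψ h))
    {A r : ℝ} (hr : 0 < r) (hψ : ∀ h, ‖h‖ ≤ r → |ψ h - ‖h‖ ^ 2 / 2| ≤ A * ‖h‖ ^ 3)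
    {ρ : ℝ} (hρ : 0 < ρ) :
    ∃ δ > 0, ∀ u : W, ‖u‖ ≤ δ →
      (∃! h, h ∈ K ∧ IsMinOn (fun h => inner ℝ h u + ψ h) K h) ∧
      ∀ h ∈ K, IsMinOn (fun h => inner ℝ h u + ψ h) K h → ‖h + u‖ ≤ ρ * ‖u‖ := by
  obtain ⟨s₀, hs₀, H⟩ :=
    exists_isMinOn_linear_perturbation hK h0 (fun u => (hconv u).convexOn) hr hψ hρ
  have huniq : ∀ u, ∀ h ∈ K, IsMinOn (fun h => inner ℝ h u + ψ h) K h →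
      ∀ h' ∈ K, IsMinOn (fun h => inner ℝ h u + ψ h) K h' → h = h' := by
    intro u h hh hm h' hh' hm'
    exact (hconv u).eq_of_isMinOn (fun z hz => Real.exp_le_exp.2 (hm hz))
      (fun z hz => Real.exp_le_exp.2 (hm' hz)) hh hh'
  refine ⟨ρ⁻¹ * s₀ / 2, by positivity, fun u hu => ⟨?_, ?_⟩⟩
  · obtain ⟨h, -, hh, hm⟩ := H s₀ hs₀ le_rfl u (hu.trans (by
      have : 0 < ρ⁻¹ * s₀ := by positivity
      linarith))
    exact ⟨h, ⟨hh, hm⟩, fun h' hh' => huniq u h' hh'.1 hh'.2 h hh hm⟩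
  · intro h hh hm
    -- Letting s decrease to ρ‖u‖ keeps the radius positive even for u = 0.
    refine le_of_forall_gt_imp_ge_of_dense fun s hs => ?_
    rcases le_or_gt s s₀ with hss | hss
    · obtain ⟨h', hb, hh', hm'⟩ := H s (lt_of_le_of_lt (by positivity) hs) hss u (by
        rw [inv_mul_eq_div, le_div_iff₀ hρ]; linarith)
      rw [huniq u h hh hm h' hh' hm']
      rw [mem_ball, dist_eq_norm, sub_neg_eq_add] at hb
      exact hb.le
    · obtain ⟨h', hb, hh', hm'⟩ := H s₀ hs₀ le_rfl u (hu.trans (by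
        have : 0 < ρ⁻¹ * s₀ := by positivity
        linarith))
      rw [huniq u h hh hm h' hh' hm']
      rw [mem_ball, dist_eq_norm, sub_neg_eq_add] at hb
      exact hb.le.trans hss.le

end Argmin

/-! ### Exponential moments and the log-Laplace transform -/

section Moments

variable {D : Type*} [MeasurableSpace D] {Q : Measure D}

/-- The norm is at most the dimension times the largest coordinate in absolute value, so exponential
moments along the coordinate axes suffice. -/
theorem integrable_exp_mul_norm {ι : Type*} [Fintype ι] [DecidableEq ι] [IsFiniteMeasure Q]
    {Y : D → EuclideanSpace ℝ ι} (hY : Measurable Y) {K : Set (EuclideanSpace ℝ ι)}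
    (hK : K ∈ 𝓝 0) (hint : ∀ h ∈ K, Integrable (fun x => Real.exp (-inner ℝ h (Y x))) Q) :
    ∃ r > 0, Integrable (fun x => Real.exp (r * ‖Y x‖)) Q := by
  obtain ⟨s, hs, hsK⟩ := Metric.mem_nhds_iff.1 hK
  set n : ℝ := (Fintype.card ι : ℝ) with hn
  have hn0 : 0 ≤ n := Nat.cast_nonneg _
  set r := s / (n + 1) with hr
  have hr0 : 0 < r := by positivity
  have hrs : r * n < s := by
    rw [hr, div_mul_eq_mul_div, div_lt_iff₀ (by positivity)]; nlinarith
  refine ⟨r, hr0, ?_⟩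
  have hint' : ∀ t : ℝ, |t| < s → ∀ i, Integrable (fun x => Real.exp (t * Y x i)) Q := by
    intro t ht i
    have := hint (EuclideanSpace.single i (-t)) (hsK (by simpa using ht))
    simpa [EuclideanSpace.inner_single_left] using this
  -- The summand 1 covers an empty index type.
  have hbound : Integrable (fun x => 1 + ∑ i, (Real.exp (r * n * Y x i)
      + Real.exp (-(r * n) * Y x i))) Q := by
    refine (integrable_const _).add (integrable_finsetSum _ fun i _ => ?_)
    have h1 : |r * n| < s := by rwa [abs_of_nonneg (by positivity)]
    exact (hint' _ h1 i).add (hint' _ (by rwa [abs_neg]) i)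
  refine hbound.mono' (by fun_prop) (ae_of_all _ fun x => ?_)
  rw [Real.norm_eq_abs, abs_of_pos (Real.exp_pos _)]
  have hpos : ∀ i, 0 ≤ Real.exp (r * n * Y x i) + Real.exp (-(r * n) * Y x i) :=
    fun i => by positivity
  rcases isEmpty_or_nonempty ι with hι | hι
  · have : Y x = 0 := Subsingleton.elim _ _
    simp [this]
  · obtain ⟨k, -, hk⟩ := Finset.exists_max_image Finset.univ (fun i => |Y x i|)
      Finset.univ_nonempty
    have hnorm : ‖Y x‖ ≤ n * |Y x k| := by
      calc ‖Y x‖ ≤ ∑ i, |Y x i| := by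
            conv_lhs => rw [← (EuclideanSpace.basisFun ι ℝ).sum_repr (Y x)]
            refine (norm_sum_le _ _).trans (Finset.sum_le_sum fun i _ => ?_)
            rw [norm_smul]; simp
        _ ≤ ∑ _i : ι, |Y x k| := Finset.sum_le_sum fun i _ => hk i (Finset.mem_univ i)
        _ = n * |Y x k| := by simp [hn]
    have h1 : Real.exp (r * ‖Y x‖) ≤
        Real.exp (r * n * Y x k) + Real.exp (-(r * n) * Y x k) := by
      calc Real.exp (r * ‖Y x‖) ≤ Real.exp (r * n * |Y x k|) := by
            rw [Real.exp_le_exp, mul_assoc]; gcongr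
        _ ≤ _ := by
            rcases abs_cases (Y x k) with h | h <;> rw [h.1]
            · linarith [Real.exp_pos (-(r * n) * Y x k)]
            · rw [mul_neg, ← neg_mul]
              linarith [Real.exp_pos ((r * n) * Y x k)]
    have h2 := Finset.single_le_sum (f := fun i => Real.exp (r * n * Y x i)
      + Real.exp (-(r * n) * Y x i)) (fun i _ => hpos i) (Finset.mem_univ k)
    simp only at h2
    linarith

variable {W : Type*} [NormedAddCommGroup W] {Y : D → W}

theorem integrable_norm_pow_of_integrable_exp [MeasurableSpace W] [OpensMeasurableSpace W]
    (hY : Measurable Y) {r : ℝ} (hr : 0 < r)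
    (hint : Integrable (fun x => Real.exp (r * ‖Y x‖)) Q) (n : ℕ) :
    Integrable (fun x => ‖Y x‖ ^ n) Q := by
  refine (hint.const_mul (n.factorial / r ^ n)).mono'
    (hY.norm.pow_const n).aestronglyMeasurable (ae_of_all _ fun x => ?_)
  have h := Real.pow_div_factorial_le_exp (r * ‖Y x‖) (by positivity) n
  rw [Real.norm_eq_abs, abs_of_nonneg (by positivity), div_mul_eq_mul_div,
    le_div_iff₀ (by positivity)]
  rw [mul_pow, div_le_iff₀ (by positivity)] at h
  linarith

variable [InnerProductSpace ℝ W]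

/-- If `Y` does not satisfy an affine relation along `K`, then the exponential of the negative
log-likelihood of the exponential family generated by `Y` is strictly convex. -/
theorem strictConvexOn_exp_inner_add_log_integral [NeZero Q] {K : Set W} (hK : Convex ℝ K)
    (hint : ∀ h ∈ K, Integrable (fun x => Real.exp (-inner ℝ h (Y x))) Q)
    (hident : ∀ h ∈ K, ∀ h' ∈ K, ∀ c, (∀ᵐ x ∂Q, inner ℝ h (Y x) - inner ℝ h' (Y x) = c) → h = h')
    (u : W) :
    StrictConvexOn ℝ K fun h =>
      Real.exp (inner ℝ h u + Real.log (∫ x, Real.exp (-inner ℝ h (Y x)) ∂Q)) := by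
  -- After exponentiation the objective is an integral of exponentials of linear functions of h, so
  -- convexity can be checked pointwise.
  set g : W → D → ℝ := fun h x => Real.exp (inner ℝ h u) * Real.exp (-inner ℝ h (Y x)) with hg
  have hgi : ∀ h ∈ K, Integrable (g h) Q := fun h hh => (hint h hh).const_mul _
  have hge : ∀ h x, g h x = Real.exp (inner ℝ h u - inner ℝ h (Y x)) := fun h x => by
    rw [hg, sub_eq_add_neg, Real.exp_add]
  have hval : ∀ h ∈ K, Real.exp (inner ℝ h u + Real.log (∫ x, Real.exp (-inner ℝ h (Y x)) ∂Q))
      = ∫ x, g h x ∂Q := by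
    intro h hh
    rw [Real.exp_add, Real.exp_log (integral_exp_pos (hint h hh)), integral_const_mul]
  refine ⟨hK, fun h hh h' hh' hne a b ha hb hab => ?_⟩
  have hmem : a • h + b • h' ∈ K := hK hh hh' ha.le hb.le hab
  simp only
  rw [hval _ hh, hval _ hh', hval _ hmem, smul_eq_mul, smul_eq_mul, ← integral_const_mul,
    ← integral_const_mul, ← integral_add ((hgi h hh).const_mul a) ((hgi h' hh').const_mul b)]
  have hexp : ∀ x, inner ℝ (a • h + b • h') u - inner ℝ (a • h + b • h') (Y x) =
      a • (inner ℝ h u - inner ℝ h (Y x)) + b • (inner ℝ h' u - inner ℝ h' (Y x)) := by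
    intro x
    simp only [inner_add_left, real_inner_smul_left, smul_eq_mul]; ring
  have hle : ∀ x, g (a • h + b • h') x ≤ a * g h x + b * g h' x := by
    intro x
    rw [hge, hge, hge, hexp]
    exact convexOn_exp.2 (Set.mem_univ _) (Set.mem_univ _) ha.le hb.le hab
  have hri : Integrable (fun x => a * g h x + b * g h' x) Q :=
    ((hgi h hh).const_mul a).add ((hgi h' hh').const_mul b)
  refine lt_of_le_of_ne (integral_mono (hgi _ hmem) hri hle) fun heq => hne ?_
  -- Equality makes the nonnegative convexity gap vanish almost everywhere. Strict convexity of exp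
  -- then makes ⟨h - h', Y⟩ constant, which identifiability excludes.
  have hzero : ∫ x, ((a * g h x + b * g h' x) - g (a • h + b • h') x) ∂Q = 0 := by
    rw [integral_sub hri (hgi _ hmem), heq, sub_self]
  rw [integral_eq_zero_iff_of_nonneg (fun x => sub_nonneg.2 (hle x))
    (hri.sub (hgi _ hmem))] at hzero
  refine hident h hh h' hh' (inner ℝ h u - inner ℝ h' u) ?_
  filter_upwards [hzero] with x hx
  by_contra hcon
  have hlt := strictConvexOn_exp.2 (Set.mem_univ (inner ℝ h u - inner ℝ h (Y x)))
    (Set.mem_univ (inner ℝ h' u - inner ℝ h' (Y x))) (fun hxy => hcon (by linarith)) ha hb hab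
  simp only [Pi.zero_apply, hge, hexp] at hx
  simp only [smul_eq_mul] at hlt hx
  linarith

variable [MeasurableSpace W] [BorelSpace W] [SecondCountableTopology W]

theorem Real.abs_exp_sub_quadratic_le (x : ℝ) :
    |Real.exp x - (1 + x + x ^ 2 / 2)| ≤ |x| ^ 3 * Real.exp |x| := by
  have h := Complex.norm_exp_sub_sum_le_norm_mul_exp (x : ℂ) 3
  simp only [Finset.sum_range_succ, Finset.sum_range_zero, Complex.norm_real,
    Real.norm_eq_abs] at h
  refine le_trans (le_of_eq ?_) h
  rw [← Real.norm_eq_abs, ← Complex.norm_real]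
  congr 1
  simp [Nat.factorial]

/-- Second order expansion of the Laplace transform of a centered isotropic vector. -/
theorem abs_integral_exp_neg_inner_sub_le [IsProbabilityMeasure Q] (hY : Measurable Y) {r : ℝ}
    (hr : 0 < r) (hint : Integrable (fun x => Real.exp (r * ‖Y x‖)) Q)
    (hmean : ∀ h, ∫ x, inner ℝ h (Y x) ∂Q = 0)
    (hcov : ∀ h, ∫ x, (inner ℝ h (Y x)) ^ 2 ∂Q = ‖h‖ ^ 2) :
    ∃ A, ∀ h : W, ‖h‖ ≤ r / 2 →
      |∫ x, Real.exp (-inner ℝ h (Y x)) ∂Q - (1 + ‖h‖ ^ 2 / 2)| ≤ A * ‖h‖ ^ 3 := by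
  -- Half of the exponent absorbs ‖Y‖³ (with 6 = 3!), the other half absorbs exp |⟨h, Y⟩| for ‖h‖ ≤
  -- r/2.
  set G : D → ℝ := fun x => 6 / (r / 2) ^ 3 * Real.exp (r * ‖Y x‖) with hG
  refine ⟨∫ x, G x ∂Q, fun h hh => ?_⟩
  have hxle : ∀ x, |inner ℝ h (Y x)| ≤ ‖h‖ * ‖Y x‖ := fun x => abs_real_inner_le_norm _ _
  have i1 : Integrable (fun x => inner ℝ h (Y x)) Q := by
    have := integrable_norm_pow_of_integrable_exp hY hr hint 1
    refine (this.const_mul ‖h‖).mono' (by fun_prop) (ae_of_all _ fun x => ?_)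
    simpa using hxle x
  have i2 : Integrable (fun x => (inner ℝ h (Y x)) ^ 2) Q := by
    have := integrable_norm_pow_of_integrable_exp hY hr hint 2
    refine (this.const_mul (‖h‖ ^ 2)).mono' (by fun_prop) (ae_of_all _ fun x => ?_)
    rw [norm_pow, ← mul_pow]
    exact pow_le_pow_left₀ (norm_nonneg _) (hxle x) 2
  have i3 : Integrable (fun x => Real.exp (-inner ℝ h (Y x))) Q := by
    refine hint.mono' (by fun_prop) (ae_of_all _ fun x => ?_)
    rw [Real.norm_eq_abs, abs_of_pos (Real.exp_pos _), Real.exp_le_exp]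
    have := neg_abs_le (inner ℝ h (Y x))
    nlinarith [hxle x, norm_nonneg (Y x)]
  have hpt : ∀ x, |Real.exp (-inner ℝ h (Y x)) -
      (1 + -inner ℝ h (Y x) + (inner ℝ h (Y x)) ^ 2 / 2)| ≤ G x * ‖h‖ ^ 3 := by
    intro x
    have h1 := Real.abs_exp_sub_quadratic_le (-inner ℝ h (Y x))
    rw [abs_neg, neg_sq] at h1
    refine h1.trans ?_
    have h2 := Real.pow_div_factorial_le_exp (r / 2 * ‖Y x‖) (by positivity) 3
    rw [mul_pow] at h2
    have h3 : ‖Y x‖ ^ 3 ≤ 6 / (r / 2) ^ 3 * Real.exp (r / 2 * ‖Y x‖) := by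
      rw [div_mul_eq_mul_div, le_div_iff₀ (by positivity)]
      rw [div_le_iff₀ (by positivity)] at h2
      norm_num [Nat.factorial] at h2 ⊢
      linarith
    calc |inner ℝ h (Y x)| ^ 3 * Real.exp |inner ℝ h (Y x)|
        ≤ (‖h‖ * ‖Y x‖) ^ 3 * Real.exp (r / 2 * ‖Y x‖) := by
          gcongr
          · exact hxle x
          · exact (hxle x).trans (by gcongr)
      _ = ‖Y x‖ ^ 3 * Real.exp (r / 2 * ‖Y x‖) * ‖h‖ ^ 3 := by ring
      _ ≤ (6 / (r / 2) ^ 3 * Real.exp (r / 2 * ‖Y x‖)) * Real.exp (r / 2 * ‖Y x‖) * ‖h‖ ^ 3 := by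
          gcongr
      _ = G x * ‖h‖ ^ 3 := by
          rw [hG, mul_assoc (6 / (r / 2) ^ 3), ← Real.exp_add]
          simp only
          congr 4; ring
  have i4 : Integrable (fun x => -inner ℝ h (Y x)) Q := i1.neg
  have i5 : Integrable (fun x => (1 : ℝ) + -inner ℝ h (Y x)) Q := (integrable_const _).add i4
  have i6 : Integrable (fun x => (1 : ℝ) + -inner ℝ h (Y x) + (inner ℝ h (Y x)) ^ 2 / 2) Q :=
    i5.add (i2.div_const 2)
  have heq : ∫ x, Real.exp (-inner ℝ h (Y x)) ∂Q - (1 + ‖h‖ ^ 2 / 2) =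
      ∫ x, (Real.exp (-inner ℝ h (Y x)) -
      (1 + -inner ℝ h (Y x) + (inner ℝ h (Y x)) ^ 2 / 2)) ∂Q := by
    rw [integral_sub i3 i6, integral_add i5 (i2.div_const 2),
      integral_add (integrable_const _) i4, integral_neg, hmean, integral_div, hcov]
    simp
  rw [heq, ← integral_mul_const, ← Real.norm_eq_abs]
  exact norm_integral_le_of_norm_le ((hint.const_mul _).mul_const _) (ae_of_all _ hpt)

theorem Real.abs_log_one_add_sub_le {z : ℝ} (hz : |z| ≤ 1 / 2) :
    |Real.log (1 + z) - z| ≤ 2 * z ^ 2 := by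
  have h := Real.abs_log_sub_add_sum_range_le (x := -z) (by rw [abs_neg]; linarith) 1
  simp only [Finset.sum_range_one, abs_neg, sub_neg_eq_add] at h
  norm_num at h
  rw [neg_add_eq_sub] at h
  refine h.trans ?_
  rw [div_le_iff₀ (by linarith)]
  nlinarith [sq_nonneg z]

/-- Second order expansion of the log-Laplace transform of a centered isotropic vector. -/
theorem abs_log_integral_exp_neg_inner_sub_le [IsProbabilityMeasure Q] (hY : Measurable Y) {r : ℝ}
    (hr : 0 < r) (hint : Integrable (fun x => Real.exp (r * ‖Y x‖)) Q)
    (hmean : ∀ h, ∫ x, inner ℝ h (Y x) ∂Q = 0)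
    (hcov : ∀ h, ∫ x, (inner ℝ h (Y x)) ^ 2 ∂Q = ‖h‖ ^ 2) :
    ∃ A, ∃ r' > 0, ∀ h : W, ‖h‖ ≤ r' →
      |Real.log (∫ x, Real.exp (-inner ℝ h (Y x)) ∂Q) - ‖h‖ ^ 2 / 2| ≤ A * ‖h‖ ^ 3 := by
  obtain ⟨A, hA⟩ := abs_integral_exp_neg_inner_sub_le hY hr hint hmean hcov
  -- With 1 + z the Laplace transform, |z| ≤ (1/2 + |A|)‖h‖². The second radius gives ‖h‖ ≤ 1 and
  -- |z| ≤ 1/2, and the constant adds the error of z to the logarithmic remainder 2z².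
  refine ⟨|A| + 2 * (1 / 2 + |A|) ^ 2, min (r / 2) (1 / (1 + 2 * |A|)), by positivity, ?_⟩
  intro h hh
  have h1 := hA h (hh.trans (min_le_left _ _))
  have h2 : ‖h‖ * (1 + 2 * |A|) ≤ 1 :=
    (le_div_iff₀ (by positivity)).1 (hh.trans (min_le_right _ _))
  have hn := norm_nonneg h
  have hA0 := abs_nonneg A
  have h3 : ‖h‖ ≤ 1 := by nlinarith
  obtain ⟨z, hz⟩ : ∃ z, ∫ x, Real.exp (-inner ℝ h (Y x)) ∂Q = 1 + z := ⟨_, by rw [add_sub_cancel]⟩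
  rw [hz] at h1 ⊢
  have h4 : |z - ‖h‖ ^ 2 / 2| ≤ |A| * ‖h‖ ^ 3 := by
    calc |z - ‖h‖ ^ 2 / 2| = |1 + z - (1 + ‖h‖ ^ 2 / 2)| := by congr 1; ring
      _ ≤ A * ‖h‖ ^ 3 := h1
      _ ≤ |A| * ‖h‖ ^ 3 := by gcongr; exact le_abs_self A
  have h5 : |z| ≤ (1 / 2 + |A|) * ‖h‖ ^ 2 := by
    have h6 : |z| ≤ |z - ‖h‖ ^ 2 / 2| + |‖h‖ ^ 2 / 2| := by
      have := abs_add_le (z - ‖h‖ ^ 2 / 2) (‖h‖ ^ 2 / 2)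
      rwa [sub_add_cancel] at this
    rw [abs_of_nonneg (by positivity : 0 ≤ ‖h‖ ^ 2 / 2)] at h6
    have h7 : |A| * ‖h‖ ^ 3 ≤ |A| * ‖h‖ ^ 2 := by
      gcongr ?_ * ?_
      exact pow_le_pow_of_le_one hn h3 (by norm_num)
    linarith
  have h6 : |z| ≤ 1 / 2 := by
    have : (1 / 2 + |A|) * ‖h‖ ^ 2 = (‖h‖ * (1 + 2 * |A|)) * ‖h‖ / 2 := by ring
    rw [this] at h5
    nlinarith
  have h7 : z ^ 2 ≤ (1 / 2 + |A|) ^ 2 * ‖h‖ ^ 3 := by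
    rw [← sq_abs z]
    calc |z| ^ 2 ≤ ((1 / 2 + |A|) * ‖h‖ ^ 2) ^ 2 := by gcongr
      _ = (1 / 2 + |A|) ^ 2 * ‖h‖ ^ 4 := by ring
      _ ≤ _ := by
        gcongr ?_ * ?_
        exact pow_le_pow_of_le_one hn h3 (by norm_num)
  calc |Real.log (1 + z) - ‖h‖ ^ 2 / 2|
      ≤ |Real.log (1 + z) - z| + |z - ‖h‖ ^ 2 / 2| := abs_sub_le _ _ _
    _ ≤ 2 * z ^ 2 + |A| * ‖h‖ ^ 3 := add_le_add (Real.abs_log_one_add_sub_le h6) h4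
    _ ≤ _ := by linarith

end Moments

/-! ### Central limit theorem, delta method, Gaussian images -/

section Limits

variable {Ω : Type*} [MeasurableSpace Ω] {P : Measure Ω} [IsProbabilityMeasure P]

/-- **Central limit theorem** for isotropic random vectors. -/
theorem tendstoInDistribution_stdGaussian {W : Type*} [NormedAddCommGroup W]
    [InnerProductSpace ℝ W] [FiniteDimensional ℝ W] [MeasurableSpace W] [BorelSpace W]
    {Y : ℕ → Ω → W} (hindep : iIndepFun Y P) (hident : ∀ i, IdentDistrib (Y i) (Y 0) P P)
    (hL2 : MemLp (Y 0) 2 P) (hmean : ∀ h, ∫ ω, inner ℝ h (Y 0 ω) ∂P = 0)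
    (hcov : ∀ h, ∫ ω, (inner ℝ h (Y 0 ω)) ^ 2 ∂P = ‖h‖ ^ 2) :
    TendstoInDistribution (fun (n : ℕ) ω => (√n)⁻¹ • ∑ i ∈ Finset.range n, Y i ω) atTop id
      (fun _ => P) (stdGaussian W) where
  forall_aemeasurable n :=
    (Finset.aemeasurable_fun_sum _ fun i _ => (hident i).aemeasurable_fst).const_smul _
  tendsto := by
    refine ProbabilityMeasure.tendsto_iff_tendsto_charFun.2 fun t => ?_
    have hv : Var[fun ω => inner ℝ t (Y 0 ω); P] = ‖t‖ ^ 2 := by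
      rw [variance_of_integral_eq_zero _ (hmean t), hcov]
      have := hL2.1.aemeasurable
      fun_prop
    have hlp : MemLp (fun ω => inner ℝ t (Y 0 ω)) 2 P := (hL2.const_inner t)
    have hclt := tendstoInDistribution_inv_sqrt_mul_sum_sub (P := P)
      (X := fun i ω => inner ℝ t (Y i ω)) (Y := id)
      (P' := gaussianReal 0 Var[fun ω => inner ℝ t (Y 0 ω); P].toNNReal)
      HasLaw.id hlp
      (hindep.comp (fun _ y => inner ℝ t y) (by fun_prop))
      (fun i => (hident i).comp (u := fun y => inner ℝ t y) (by fun_prop))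
    -- Cramér–Wold: the characteristic function of the vector sum at t is that of the scalar sum of
    -- ⟨t, Y i⟩ at 1.
    have h1 := ProbabilityMeasure.tendsto_iff_tendsto_charFun.1 hclt.tendsto 1
    simp only [ProbabilityMeasure.coe_mk, Measure.map_id, hv, hmean, mul_zero, sub_zero,
      charFun_gaussianReal] at h1
    simp only [ProbabilityMeasure.coe_mk, Measure.map_id, charFun_stdGaussian]
    have hmeas : ∀ n : ℕ, AEMeasurable (fun ω => (√n)⁻¹ • ∑ i ∈ Finset.range n, Y i ω) P :=
      fun n =>
        (Finset.aemeasurable_fun_sum _ fun i _ => (hident i).aemeasurable_fst).const_smul _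
    have hmeas' : ∀ n : ℕ,
        AEMeasurable (fun ω => (√n)⁻¹ * ∑ i ∈ Finset.range n, inner ℝ t (Y i ω)) P :=
      fun n => (Finset.aemeasurable_fun_sum _ fun i _ => by
        have := (hident i).aemeasurable_fst
        fun_prop).const_mul _
    convert! h1 using 2 with n
    · rw [charFun_apply, charFun_apply, integral_map (hmeas n) (by fun_prop),
        integral_map (hmeas' n) (by fun_prop)]
      congr 1 with ω
      simp only [real_inner_comm t, inner_smul_right, inner_sum]
      simp
    · congr 1
      simp
      ring

/-- **Delta method**: if `a n` converges in distribution and `Z n + C (a n)` is almost surely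
negligible compared to `a n`, then `Z n` has the limit of `-C (a n)`. -/
theorem tendstoInDistribution_neg_clm_of_isLittleO {W F Ω' : Type*} [NormedAddCommGroup W]
    [NormedSpace ℝ W] [MeasurableSpace W] [BorelSpace W] [SecondCountableTopology W]
    [NormedAddCommGroup F] [NormedSpace ℝ F] [MeasurableSpace F] [BorelSpace F]
    [SecondCountableTopology F] [MeasurableSpace Ω'] {P' : Measure Ω'} [IsProbabilityMeasure P']
    {a : ℕ → Ω → W} {G : Ω' → W} (ha : TendstoInDistribution a atTop G (fun _ => P) P')
    {Z : ℕ → Ω → F} (hZ : ∀ n, AEMeasurable (Z n) P) (C : W →L[ℝ] F)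
    (hrem : ∀ᵐ ω ∂P, ∀ ρ > 0, ∀ᶠ n in atTop, ‖Z n ω + C (a n ω)‖ ≤ ρ * ‖a n ω‖) :
    TendstoInDistribution Z atTop (fun ω => -C (G ω)) (fun _ => P) P' := by
  have ham := ha.forall_aemeasurable
  -- The +1 avoids dividing by zero. Since v → 0 almost surely and Z = -C a + (‖a‖ + 1) v is
  -- continuous in (a, v), Slutsky's theorem applies.
  set v : ℕ → Ω → F := fun n ω => (‖a n ω‖ + 1)⁻¹ • (Z n ω + C (a n ω)) with hv
  have hvm : ∀ n, AEMeasurable (v n) P := fun n =>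
    (((ham n).norm.add_const 1).inv).smul ((hZ n).add (C.measurable.comp_aemeasurable (ham n)))
  have hv0 : TendstoInMeasure P v atTop (fun _ => 0) := by
    refine tendstoInMeasure_of_tendsto_ae (fun n => (hvm n).aestronglyMeasurable) ?_
    filter_upwards [hrem] with ω hω
    rw [Metric.tendsto_nhds]
    intro ε hε
    filter_upwards [hω (ε / 2) (by positivity)] with n hn
    have hpos : 0 < ‖a n ω‖ + 1 := by positivity
    rw [dist_zero_right, hv, norm_smul, norm_inv, Real.norm_of_nonneg hpos.le, inv_mul_eq_div,
      div_lt_iff₀ hpos]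
    nlinarith [norm_nonneg (a n ω)]
  have hlim := ha.continuous_comp_prodMk_of_tendstoInMeasure_const
    (g := fun x : W × F => -C x.1 + (‖x.1‖ + 1) • x.2) (by fun_prop) hv0 hvm
  have hlimit : (fun ω => -C (G ω)) = fun ω => -C (G ω) + (‖G ω‖ + 1) • (0 : F) := by simp
  rw [hlimit]
  convert! hlim using 3 with n ω
  · have hpos : ‖a n ω‖ + 1 ≠ 0 := by positivity
    simp only [hv, smul_smul, mul_inv_cancel₀ hpos, one_smul]
    abel

/-- A linear image of the standard Gaussian measure is a Gaussian measure. -/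
theorem stdGaussian_map_eq_multivariateGaussian {ι κ : Type*} [Fintype ι] [DecidableEq ι]
    [Fintype κ] [DecidableEq κ] (A : Matrix ι κ ℝ)
    (C : EuclideanSpace ℝ κ →L[ℝ] EuclideanSpace ℝ ι) (hC : ∀ w, (C w).ofLp = A *ᵥ w.ofLp) :
    (stdGaussian (EuclideanSpace ℝ κ)).map C = multivariateGaussian 0 (A * Aᵀ) := by
  have hS : (A * Aᵀ).PosSemidef := by
    simpa using Matrix.posSemidef_self_mul_conjTranspose A
  refine Measure.ext_of_charFun (funext fun t => ?_)
  have h1 : charFun ((stdGaussian (EuclideanSpace ℝ κ)).map C) t =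
      charFun (stdGaussian (EuclideanSpace ℝ κ)) (WithLp.toLp 2 (Aᵀ *ᵥ t.ofLp)) := by
    rw [charFun_apply, charFun_apply, integral_map (by fun_prop) (by fun_prop)]
    congr 1 with w
    congr 3
    simp only [EuclideanSpace.inner_eq_star_dotProduct, hC, star_trivial]
    rw [Matrix.dotProduct_mulVec, Matrix.mulVec_transpose]
  rw [h1, charFun_multivariateGaussian hS, charFun_stdGaussian]
  congr 1
  have h2 : ‖WithLp.toLp 2 (Aᵀ *ᵥ t.ofLp)‖ ^ 2 = t.ofLp ⬝ᵥ (A * Aᵀ) *ᵥ t.ofLp := by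
    rw [← real_inner_self_eq_norm_sq, EuclideanSpace.inner_eq_star_dotProduct, star_trivial,
      ← Matrix.mulVec_mulVec, Matrix.dotProduct_mulVec t.ofLp A, ← Matrix.mulVec_transpose]
  rw [← h2]
  simp [neg_div]

end Limits

/-! ### Likelihood of a centred isotropic exponential family -/

section CanonicalFamily

variable {D Ω : Type*} [MeasurableSpace D] [MeasurableSpace Ω] {Q : Measure D} {P : Measure Ω}
  {κ : Type*} [Fintype κ] {Y : D → EuclideanSpace ℝ κ} {K : Set (EuclideanSpace ℝ κ)}
  {X : ℕ → Ω → D}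

theorem tendstoInDistribution_sqrt_smul_mean [IsProbabilityMeasure P] (hY : Measurable Y)
    (hint : MemLp Y 2 Q) (hmean : ∀ h, ∫ x, inner ℝ h (Y x) ∂Q = 0)
    (hcov : ∀ h, ∫ x, (inner ℝ h (Y x)) ^ 2 ∂Q = ‖h‖ ^ 2)
    (hlaw : ∀ i, HasLaw (X i) Q P) (hindep : iIndepFun X P) :
    TendstoInDistribution
      (fun (n : ℕ) ω => √n • (n : ℝ)⁻¹ • ∑ i ∈ Finset.range n, Y (X i ω)) atTop id
      (fun _ => P) (stdGaussian (EuclideanSpace ℝ κ)) := by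
  have hlawY : ∀ i, IdentDistrib (fun ω => Y (X i ω)) (fun ω => Y (X 0 ω)) P P := fun i =>
    IdentDistrib.comp ⟨(hlaw i).aemeasurable, (hlaw 0).aemeasurable,
      (hlaw i).map_eq.trans (hlaw 0).map_eq.symm⟩ hY
  have hmap : ∀ f : D → ℝ, Measurable f → ∫ ω, f (X 0 ω) ∂P = ∫ x, f x ∂Q := by
    intro f hf
    rw [← (hlaw 0).map_eq, integral_map (hlaw 0).aemeasurable hf.aestronglyMeasurable]
  have h := tendstoInDistribution_stdGaussian (hindep.comp (fun _ => Y) fun _ => hY) hlawY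
    (by
      have := (hlaw 0).map_eq ▸ hint
      exact this.comp_of_map (hlaw 0).aemeasurable)
    (fun h => (hmap (fun x => inner ℝ h (Y x)) (by fun_prop)).trans (hmean h))
    (fun h => (hmap (fun x => (inner ℝ h (Y x)) ^ 2) (by fun_prop)).trans (hcov h))
  convert! h using 3 with n ω
  rw [smul_smul, ← div_eq_mul_inv, Real.sqrt_div_self]
  rfl

/-- Almost sure existence, uniqueness and linearization of the minimizer of the negative
log-likelihood of the exponential family generated by a centered isotropic statistic. -/
theorem ae_eventually_existsUnique_isMinOn_logLikelihood [DecidableEq κ]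
    [IsProbabilityMeasure Q] (hY : Measurable Y) (hK : IsOpen K) (hKc : Convex ℝ K) (h0 : 0 ∈ K)
    (hint : ∀ h ∈ K, Integrable (fun x => Real.exp (-inner ℝ h (Y x))) Q)
    (hident : ∀ h ∈ K, ∀ h' ∈ K, ∀ c, (∀ᵐ x ∂Q, inner ℝ h (Y x) - inner ℝ h' (Y x) = c) → h = h')
    (hmean : ∀ h, ∫ x, inner ℝ h (Y x) ∂Q = 0)
    (hcov : ∀ h, ∫ x, (inner ℝ h (Y x)) ^ 2 ∂Q = ‖h‖ ^ 2)
    (hlaw : ∀ i, HasLaw (X i) Q P) (hindep : iIndepFun X P) :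
    ∀ᵐ ω ∂P, ∀ ρ > 0, ∀ᶠ n : ℕ in atTop, ∀ u,
      u = (n : ℝ)⁻¹ • ∑ i ∈ Finset.range n, Y (X i ω) →
      (∃! h, h ∈ K ∧ IsMinOn
        (fun h => inner ℝ h u + Real.log (∫ x, Real.exp (-inner ℝ h (Y x)) ∂Q)) K h) ∧
      ∀ h ∈ K, IsMinOn
        (fun h => inner ℝ h u + Real.log (∫ x, Real.exp (-inner ℝ h (Y x)) ∂Q)) K h →
        ‖h + u‖ ≤ ρ * ‖u‖ := by
  obtain ⟨r, hr, hexp⟩ := integrable_exp_mul_norm hY (hK.mem_nhds h0) hint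
  obtain ⟨A, r', hr', hψ⟩ := abs_log_integral_exp_neg_inner_sub_le hY hr hexp hmean hcov
  have hconv := strictConvexOn_exp_inner_add_log_integral hKc hint hident
  have hYint : Integrable Y Q := by
    rw [← integrable_norm_iff hY.aestronglyMeasurable]
    simpa using integrable_norm_pow_of_integrable_exp hY hr hexp 1
  have hYmean : ∫ x, Y x ∂Q = 0 := by
    refine ext_inner_left ℝ fun h => ?_
    rw [← integral_inner hYint, hmean, inner_zero_right]
  have hlawY : ∀ i, IdentDistrib (fun ω => Y (X i ω)) (fun ω => Y (X 0 ω)) P P := fun i =>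
    IdentDistrib.comp ⟨(hlaw i).aemeasurable, (hlaw 0).aemeasurable,
      (hlaw i).map_eq.trans (hlaw 0).map_eq.symm⟩ hY
  have hsl := strong_law_ae (μ := P) (fun i ω => Y (X i ω))
    (by
      have := (hlaw 0).map_eq ▸ hYint
      exact this.comp_aemeasurable (hlaw 0).aemeasurable)
    (fun i j hij => (hindep.comp (fun _ => Y) fun _ => hY).indepFun hij) hlawY
  have hm : ∫ ω, Y (X 0 ω) ∂P = 0 := by
    rw [← hYmean, ← (hlaw 0).map_eq, integral_map (hlaw 0).aemeasurable
      hY.aestronglyMeasurable]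
  rw [hm] at hsl
  -- The null set comes from the strong law alone, so it serves every ρ.
  filter_upwards [hsl] with ω hω ρ hρ
  obtain ⟨δ, hδ, hδu⟩ := existsUnique_isMinOn_linear_perturbation hK h0 hconv hr' hψ hρ
  have := hω.norm
  rw [norm_zero] at this
  filter_upwards [this.eventually (gt_mem_nhds hδ)] with n hn u hu
  subst hu
  exact hδu _ hn.le

end CanonicalFamily

/-! ### Tilting, identifiability and Fisher information of the trace model -/

namespace ExpTrace

section TraceInner

variable {q : ℕ}

theorem traceInner_eq_sum (A B : Matrix (Fin q) (Fin q) ℝ) :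
    traceInner A B = ∑ j, ∑ i, A i j * B i j := by
  simp [traceInner, Matrix.trace, Matrix.mul_apply]

theorem traceInner_add_left (A A' B : Matrix (Fin q) (Fin q) ℝ) :
    traceInner (A + A') B = traceInner A B + traceInner A' B := by
  simp [traceInner, Matrix.add_mul]

theorem traceInner_smul_left (c : ℝ) (A B : Matrix (Fin q) (Fin q) ℝ) :
    traceInner (c • A) B = c * traceInner A B := by
  simp [traceInner]

theorem traceInner_smul_right (c : ℝ) (A B : Matrix (Fin q) (Fin q) ℝ) :
    traceInner A (c • B) = c * traceInner A B := by
  simp [traceInner]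

theorem traceInner_sum_left {ι : Type*} (s : Finset ι) (A : ι → Matrix (Fin q) (Fin q) ℝ)
    (B : Matrix (Fin q) (Fin q) ℝ) :
    traceInner (∑ i ∈ s, A i) B = ∑ i ∈ s, traceInner (A i) B := by
  simp [traceInner, Matrix.transpose_sum, Matrix.sum_mul, Matrix.trace_sum]

theorem traceInner_sum_right {ι : Type*} (s : Finset ι) (A : Matrix (Fin q) (Fin q) ℝ)
    (B : ι → Matrix (Fin q) (Fin q) ℝ) :
    traceInner A (∑ i ∈ s, B i) = ∑ i ∈ s, traceInner A (B i) := by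
  simp [traceInner, Matrix.mul_sum, Matrix.trace_sum]

end TraceInner

namespace TraceModel

variable {p q : ℕ} (E : TraceModel p q)

theorem measurable_traceInner (A : Matrix (Fin q) (Fin q) ℝ) :
    Measurable fun x => traceInner A (E.T x) := by
  simp only [traceInner_eq_sum]
  exact Finset.measurable_sum _ fun j _ => Finset.measurable_sum _ fun i _ =>
    (E.measurable_T i j).const_mul _

theorem measurable_ofReal_exp_neg_traceInner (A : Matrix (Fin q) (Fin q) ℝ) :
    Measurable fun x => ENNReal.ofReal (Real.exp (-traceInner A (E.T x))) :=
  (E.measurable_traceInner A).neg.exp.ennreal_ofReal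

theorem measurable_ofReal_exp_neg_traceInner_add (A : Matrix (Fin q) (Fin q) ℝ) :
    Measurable fun x => ENNReal.ofReal (Real.exp (-traceInner A (E.T x) + E.ξ x)) :=
  ((E.measurable_traceInner A).neg.add E.measurable_ξ).exp.ennreal_ofReal

theorem measurable_density (M : Matrix (Fin q) (Fin q) ℝ) : Measurable (E.density M) :=
  (((E.measurable_traceInner M).neg.add E.measurable_ξ).sub_const _).exp

/-- Exponential tilting: multiplying f_M by exp(-⟨A, T⟩) shifts the parameter to M + A up to
normalization. -/
theorem lintegral_exp_law (M A : Matrix (Fin q) (Fin q) ℝ) :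
    ∫⁻ x, ENNReal.ofReal (Real.exp (-traceInner A (E.T x))) ∂E.law M =
      ENNReal.ofReal (Real.exp (-E.γ M)) * E.partition (M + A) := by
  rw [law, lintegral_withDensity_eq_lintegral_mul _ (E.measurable_density M).ennreal_ofReal
    (E.measurable_ofReal_exp_neg_traceInner A), partition, ← lintegral_const_mul _
    (E.measurable_ofReal_exp_neg_traceInner_add _)]
  refine lintegral_congr fun x => ?_
  simp only [Pi.mul_apply, density]
  rw [← ENNReal.ofReal_mul (Real.exp_nonneg _), ← ENNReal.ofReal_mul (Real.exp_nonneg _),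
    ← Real.exp_add, ← Real.exp_add, traceInner_add_left]
  congr 2; ring

theorem integrable_exp_law {M A : Matrix (Fin q) (Fin q) ℝ} (h : E.partition (M + A) < ∞) :
    Integrable (fun x => Real.exp (-traceInner A (E.T x))) (E.law M) := by
  refine ⟨(E.measurable_traceInner A).neg.exp.aestronglyMeasurable, ?_⟩
  rw [hasFiniteIntegral_iff_ofReal (ae_of_all _ fun x => (Real.exp_pos _).le),
    E.lintegral_exp_law]
  exact ENNReal.mul_lt_top ENNReal.ofReal_lt_top h

theorem γ_add {M A : Matrix (Fin q) (Fin q) ℝ} [NeZero (E.law M)] (h : E.partition (M + A) < ∞) :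
    E.γ (M + A) = E.γ M + Real.log (∫ x, Real.exp (-traceInner A (E.T x)) ∂E.law M) := by
  have hi := E.integrable_exp_law h
  have hpos := integral_exp_pos hi
  have heq : ∫ x, Real.exp (-traceInner A (E.T x)) ∂E.law M =
      Real.exp (-E.γ M) * (E.partition (M + A)).toReal := by
    rw [integral_eq_lintegral_of_nonneg_ae (ae_of_all _ fun x => (Real.exp_pos _).le)
      hi.aestronglyMeasurable, E.lintegral_exp_law, ENNReal.toReal_mul,
      ENNReal.toReal_ofReal (Real.exp_nonneg _)]
  rw [heq] at hpos ⊢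
  rw [Real.log_mul (Real.exp_pos _).ne' (right_ne_zero_of_mul hpos.ne'), Real.log_exp, γ]
  ring

/-- The density is strictly positive everywhere. -/
theorem ae_of_ae_law {M : Matrix (Fin q) (Fin q) ℝ} {s : E.D → Prop} (h : ∀ᵐ x ∂E.law M, s x) :
    ∀ᵐ x ∂E.ν, s x :=
  (withDensity_absolutelyContinuous' (E.measurable_density M).ennreal_ofReal.aemeasurable
    (ae_of_all _ fun _ => (ENNReal.ofReal_pos.2 (Real.exp_pos _)).ne')).ae_le h

/-- Parameters whose statistics differ by a constant coincide. -/
theorem IsParameterSpace.eq_of_ae_sub_eq_const {E : TraceModel p q}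
    {L : AffineSubspace ℝ (Matrix (Fin q) (Fin q) ℝ)}
    {𝔐 : Set (Matrix (Fin q) (Fin q) ℝ)} (h𝔐 : E.IsParameterSpace L 𝔐)
    {M N N' : Matrix (Fin q) (Fin q) ℝ} [NeZero (E.law M)] (hN : N ∈ 𝔐) (hN' : N' ∈ 𝔐) {c : ℝ}
    (hc : ∀ᵐ x ∂E.law M, traceInner N (E.T x) - traceInner N' (E.T x) = c) : N = N' := by
  have hc' := E.ae_of_ae_law hc
  have hfin : E.partition N' < ∞ := interior_subset (s := {M | E.partition M < ∞}) (h𝔐.subset hN')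
  have hν : E.ν ≠ 0 := by
    intro h
    exact NeZero.ne (E.law M) (by simp [law, h])
  have hpos : E.partition N' ≠ 0 := by
    rw [partition, Ne, lintegral_eq_zero_iff
      (E.measurable_ofReal_exp_neg_traceInner_add _)]
    intro h
    refine hν (ae_eq_bot.1 ?_)
    rw [← Filter.empty_mem_iff_bot]
    filter_upwards [h] with x hx
    exact absurd hx (ENNReal.ofReal_pos.2 (Real.exp_pos _)).ne'
  have hpart : E.partition N = ENNReal.ofReal (Real.exp (-c)) * E.partition N' := by
    rw [partition, partition, ← lintegral_const_mul _
      (E.measurable_ofReal_exp_neg_traceInner_add _)]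
    refine lintegral_congr_ae ?_
    filter_upwards [hc'] with x hx
    rw [← ENNReal.ofReal_mul (Real.exp_nonneg _), ← Real.exp_add]
    congr 2; linarith
  have hγ : E.γ N = -c + E.γ N' := by
    rw [γ, hpart, ENNReal.toReal_mul, ENNReal.toReal_ofReal (Real.exp_nonneg _),
      Real.log_mul (Real.exp_pos _).ne' (ENNReal.toReal_ne_zero.2 ⟨hpos, hfin.ne⟩),
      Real.log_exp, γ]
  refine h𝔐.injective N hN N' hN' ?_
  filter_upwards [hc'] with x hx
  simp only [density, hγ]
  congr 1; linarith

section Fisher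

variable {E} {M : Matrix (Fin q) (Fin q) ℝ}

theorem eventually_partition_lt_top (hM : M ∈ E.naturalParameters)
    (A : Matrix (Fin q) (Fin q) ℝ) : ∀ᶠ t : ℝ in 𝓝 0, E.partition (M + t • A) < ∞ := by
  have hc : Tendsto (fun t : ℝ => M + t • A) (𝓝 0) (𝓝 M) := by
    have : Continuous fun t : ℝ => M + t • A := by fun_prop
    simpa using this.tendsto 0
  exact hc.eventually (mem_interior_iff_mem_nhds.1 hM)

theorem zero_mem_interior_integrableExpSet (hM : M ∈ E.naturalParameters)
    (A : Matrix (Fin q) (Fin q) ℝ) :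
    (0 : ℝ) ∈ interior (integrableExpSet (fun x => -traceInner A (E.T x)) (E.law M)) := by
  rw [mem_interior_iff_mem_nhds]
  filter_upwards [eventually_partition_lt_top hM A] with t ht
  have := E.integrable_exp_law ht
  simpa [integrableExpSet, traceInner_smul_left] using this

theorem memLp_traceInner (hM : M ∈ E.naturalParameters) (A : Matrix (Fin q) (Fin q) ℝ) :
    MemLp (fun x => traceInner A (E.T x)) 2 (E.law M) := by
  have := (memLp_of_mem_interior_integrableExpSet (zero_mem_interior_integrableExpSet hM A) 2).neg
  convert! this using 1
  ext x; simp

/-- Along M + tA the log-density is affine in t minus the cumulant generating function of -⟨A, T⟩,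
whose derivative at 0 is the mean. -/
theorem score_eq [IsProbabilityMeasure (E.law M)] (hM : M ∈ E.naturalParameters)
    (A : Matrix (Fin q) (Fin q) ℝ) (x : E.D) :
    E.score M A x =
      -(traceInner A (E.T x) - ∫ y, traceInner A (E.T y) ∂E.law M) := by
  have h0 := zero_mem_interior_integrableExpSet hM A
  have hcgf : HasDerivAt (cgf (fun x => -traceInner A (E.T x)) (E.law M))
      (-∫ y, traceInner A (E.T y) ∂E.law M) 0 := by
    have h := (analyticAt_cgf h0).differentiableAt.hasDerivAt
    rw [deriv_cgf_zero h0, integral_neg] at h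
    simpa using h
  have hlin : HasDerivAt (fun t : ℝ => -traceInner M (E.T x) + E.ξ x - E.γ M
      - t * traceInner A (E.T x)) (-traceInner A (E.T x)) 0 := by
    simpa using ((hasDerivAt_id (0 : ℝ)).mul_const (traceInner A (E.T x))).const_sub
      (-traceInner M (E.T x) + E.ξ x - E.γ M)
  have hev : (fun t : ℝ => Real.log (E.density (M + t • A) x)) =ᶠ[𝓝 0] fun t =>
      (-traceInner M (E.T x) + E.ξ x - E.γ M - t * traceInner A (E.T x)) -
        cgf (fun x => -traceInner A (E.T x)) (E.law M) t := by
    filter_upwards [eventually_partition_lt_top hM A] with t ht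
    rw [density, Real.log_exp, E.γ_add ht, traceInner_add_left, traceInner_smul_left, cgf, mgf]
    simp only [traceInner_smul_left, mul_neg]
    ring
  rw [score, lineDeriv, hev.deriv_eq, (hlin.fun_sub hcgf).deriv]
  ring

theorem fisher_eq_covariance [IsProbabilityMeasure (E.law M)] (hM : M ∈ E.naturalParameters)
    (A B : Matrix (Fin q) (Fin q) ℝ) :
    E.fisher M A B =
      cov[fun x => traceInner A (E.T x), fun x => traceInner B (E.T x); E.law M] := by
  simp only [fisher, covariance, score_eq hM, neg_mul_neg]

theorem fisher_sum_sum [IsProbabilityMeasure (E.law M)] (hM : M ∈ E.naturalParameters) {d : ℕ}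
    (b : Fin d → Matrix (Fin q) (Fin q) ℝ) (v w : Fin d → ℝ) :
    E.fisher M (∑ k, v k • b k) (∑ l, w l • b l) = v ⬝ᵥ E.fisherMatrix M b *ᵥ w := by
  rw [fisher_eq_covariance hM]
  simp only [traceInner_sum_left]
  rw [covariance_fun_sum_fun_sum (fun k => memLp_traceInner hM _)
    (fun l => memLp_traceInner hM _)]
  simp only [traceInner_smul_left, covariance_const_mul_left, covariance_const_mul_right,
    ← fisher_eq_covariance hM, dotProduct, mulVec, fisherMatrix, Matrix.of_apply, Finset.mul_sum]
  refine Finset.sum_congr rfl fun k _ => Finset.sum_congr rfl fun l _ => ?_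
  ring

/-- The Fisher information is positive definite along the parameter space. -/
theorem IsParameterSpace.posDef_fisherMatrix {L : AffineSubspace ℝ (Matrix (Fin q) (Fin q) ℝ)}
    {𝔐 : Set (Matrix (Fin q) (Fin q) ℝ)} (h𝔐 : E.IsParameterSpace L 𝔐) (hM : M ∈ 𝔐)
    [IsProbabilityMeasure (E.law M)] {d : ℕ} (b : Module.Basis (Fin d) ℝ L.direction) :
    (E.fisherMatrix M (fun k => (b k : Matrix (Fin q) (Fin q) ℝ))).PosDef := by
  have hM' := h𝔐.subset hM
  refine Matrix.PosDef.of_dotProduct_mulVec_pos ?_ fun {v} hv => ?_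
  · ext k l
    simp only [Matrix.conjTranspose_apply, fisherMatrix, Matrix.of_apply, star_trivial, fisher]
    simp only [mul_comm]
  · rw [star_trivial, ← fisher_sum_sum hM']
    set A : L.direction := ∑ k, v k • b k with hA
    have hAc : (∑ k, v k • (b k : Matrix (Fin q) (Fin q) ℝ)) = A := by simp [hA]
    rw [hAc, fisher_eq_covariance hM',
      covariance_self (E.measurable_traceInner _).aemeasurable]
    refine lt_of_le_of_ne (variance_nonneg _ _) fun hzero => hv ?_
    -- Zero variance makes ⟨A, T⟩ constant. Relative openness supplies t ≠ 0 with M + tA in the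
    -- parameter space, and injectivity forces tA = 0.
    have hae := ae_eq_integral_of_variance_eq_zero (memLp_traceInner hM' A) hzero.symm
    obtain ⟨U, hU, rfl⟩ := h𝔐.relOpen
    have hc : Tendsto (fun t : ℝ => M + t • (A : Matrix (Fin q) (Fin q) ℝ)) (𝓝[≠] 0) (𝓝 M) := by
      have : Continuous fun t : ℝ => M + t • (A : Matrix (Fin q) (Fin q) ℝ) := by fun_prop
      simpa using (this.tendsto 0).mono_left nhdsWithin_le_nhds
    obtain ⟨t, htU, ht0⟩ :=
      ((hc.eventually (hU.mem_nhds hM.1)).and eventually_mem_nhdsWithin).exists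
    have hmem : M + t • (A : Matrix (Fin q) (Fin q) ℝ) ∈ U ∩ L := by
      refine ⟨htU, ?_⟩
      have := AffineSubspace.vadd_mem_of_mem_direction (L.direction.smul_mem t A.2) hM.2
      rwa [vadd_eq_add, add_comm] at this
    have heq := h𝔐.eq_of_ae_sub_eq_const (M := M) hmem hM
      (c := t * ∫ x, traceInner A (E.T x) ∂E.law M) (by
        filter_upwards [hae] with x hx
        rw [traceInner_add_left, traceInner_smul_left, hx]; ring)
    have hA0 : A = 0 := by
      have : t • (A : Matrix (Fin q) (Fin q) ℝ) = 0 := by simpa using heq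
      exact Subtype.ext ((smul_eq_zero.1 this).resolve_left ht0)
    funext k
    exact Fintype.linearIndependent_iff.1 b.linearIndependent v (hA ▸ hA0) k

end Fisher

end TraceModel

end ExpTrace

/-! ### Whitened coordinates -/

open scoped MatrixOrder Matrix.Norms.L2Operator in
theorem Matrix.PosDef.exists_transpose_mul_self {d : ℕ} {J : Matrix (Fin d) (Fin d) ℝ}
    (hJ : J.PosDef) : ∃ B : Matrix (Fin d) (Fin d) ℝ, IsUnit B.det ∧ J = Bᵀ * B := by
  obtain ⟨B, hB⟩ := CStarAlgebra.nonneg_iff_eq_star_mul_self.1 hJ.posSemidef.nonneg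
  refine ⟨B, ?_, by simpa [Matrix.star_eq_conjTranspose] using hB⟩
  have := hJ.det_pos
  rw [hB, Matrix.det_mul] at this
  exact (right_ne_zero_of_mul this.ne').isUnit

namespace ExpTrace

namespace TraceModel

variable {p q : ℕ} {E : TraceModel p q}

/-- The linear map `w ↦ ∑ₗ (G w)ₗ bₗ`. -/
noncomputable def parametrization {d : ℕ} (G : Matrix (Fin d) (Fin d) ℝ)
    (b : Fin d → Matrix (Fin q) (Fin q) ℝ) :
    EuclideanSpace ℝ (Fin d) →ₗ[ℝ] Matrix (Fin q) (Fin q) ℝ where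
  toFun w := ∑ l, (G *ᵥ w.ofLp) l • b l
  map_add' v w := by simp [Matrix.mulVec_add, add_smul, Finset.sum_add_distrib]
  map_smul' c w := by simp [Matrix.mulVec_smul, mul_smul, Finset.smul_sum]

theorem parametrization_apply {d : ℕ} (G : Matrix (Fin d) (Fin d) ℝ)
    (b : Fin d → Matrix (Fin q) (Fin q) ℝ) (w : EuclideanSpace ℝ (Fin d)) :
    parametrization G b w = ∑ l, (G *ᵥ w.ofLp) l • b l := rfl

/-- The statistic `⟨C ·, T x⟩`, centered under `law M`. -/
noncomputable def centeredStatistic (E : TraceModel p q) (M : Matrix (Fin q) (Fin q) ℝ) {d : ℕ}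
    (C : EuclideanSpace ℝ (Fin d) →ₗ[ℝ] Matrix (Fin q) (Fin q) ℝ) (x : E.D) :
    EuclideanSpace ℝ (Fin d) :=
  WithLp.toLp 2 fun k => traceInner (C (EuclideanSpace.single k 1)) (E.T x) -
    ∫ y, traceInner (C (EuclideanSpace.single k 1)) (E.T y) ∂E.law M

section Centered

variable {M : Matrix (Fin q) (Fin q) ℝ} {d : ℕ}
  {C : EuclideanSpace ℝ (Fin d) →ₗ[ℝ] Matrix (Fin q) (Fin q) ℝ}

theorem measurable_centeredStatistic : Measurable (E.centeredStatistic M C) := by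
  refine (WithLp.measurable_toLp 2 _).comp (measurable_pi_iff.2 fun k => ?_)
  exact (E.measurable_traceInner _).sub_const _

/-- The statistic is the adjoint of C applied to T, minus its mean; expanding h in the standard
basis shows this. -/
theorem inner_centeredStatistic [IsProbabilityMeasure (E.law M)] (hM : M ∈ E.naturalParameters)
    (h : EuclideanSpace ℝ (Fin d)) (x : E.D) :
    inner ℝ h (E.centeredStatistic M C x) =
      traceInner (C h) (E.T x) - ∫ y, traceInner (C h) (E.T y) ∂E.law M := by
  have hsum : C h = ∑ k, h k • C (EuclideanSpace.single k 1) := by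
    conv_lhs => rw [← (EuclideanSpace.basisFun (Fin d) ℝ).sum_repr h]
    simp
  have hT : ∀ y, traceInner (C h) (E.T y) =
      ∑ k, h k * traceInner (C (EuclideanSpace.single k 1)) (E.T y) := by
    intro y
    rw [hsum, traceInner_sum_left]
    simp only [traceInner_smul_left]
  simp only [hT]
  rw [integral_finsetSum _ fun k _ =>
    ((memLp_traceInner hM _).integrable (by norm_num)).const_mul _]
  simp only [integral_const_mul, ← Finset.sum_sub_distrib, ← mul_sub]
  simp [centeredStatistic, PiLp.inner_apply, mul_comm]

theorem integral_inner_centeredStatistic [IsProbabilityMeasure (E.law M)]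
    (hM : M ∈ E.naturalParameters) (h : EuclideanSpace ℝ (Fin d)) :
    ∫ x, inner ℝ h (E.centeredStatistic M C x) ∂E.law M = 0 := by
  simp only [inner_centeredStatistic hM]
  rw [integral_sub ((memLp_traceInner hM _).integrable (by norm_num)) (integrable_const _)]
  simp

theorem integral_inner_centeredStatistic_sq [IsProbabilityMeasure (E.law M)]
    (hM : M ∈ E.naturalParameters) (h : EuclideanSpace ℝ (Fin d)) :
    ∫ x, (inner ℝ h (E.centeredStatistic M C x)) ^ 2 ∂E.law M = E.fisher M (C h) (C h) := by
  simp only [inner_centeredStatistic hM, fisher, score_eq hM, neg_mul_neg, sq]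

theorem exp_neg_inner_centeredStatistic [IsProbabilityMeasure (E.law M)]
    (hM : M ∈ E.naturalParameters) (h : EuclideanSpace ℝ (Fin d)) (x : E.D) :
    Real.exp (-inner ℝ h (E.centeredStatistic M C x)) =
      Real.exp (∫ y, traceInner (C h) (E.T y) ∂E.law M) *
        Real.exp (-traceInner (C h) (E.T x)) := by
  rw [inner_centeredStatistic hM, ← Real.exp_add]
  congr 1; ring

/-- The negative log-likelihood in the coordinates `h ↦ M + C h`. -/
theorem traceInner_gram_add_γ [IsProbabilityMeasure (E.law M)] (hM : M ∈ E.naturalParameters)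
    {h : EuclideanSpace ℝ (Fin d)} (hh : E.partition (M + C h) < ∞) {n : ℕ} (hn : n ≠ 0)
    (x : ℕ → E.D) :
    traceInner (M + C h) (E.gram fun i : Fin n => x i) + E.γ (M + C h) =
      (traceInner M (E.gram fun i : Fin n => x i) + E.γ M) +
      (inner ℝ h ((n : ℝ)⁻¹ • ∑ i ∈ Finset.range n, E.centeredStatistic M C (x i)) +
        Real.log (∫ y, Real.exp (-inner ℝ h (E.centeredStatistic M C y)) ∂E.law M)) := by
  have hpos := integral_exp_pos (E.integrable_exp_law hh)
  simp only [exp_neg_inner_centeredStatistic hM]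
  rw [integral_const_mul, Real.log_mul (Real.exp_pos _).ne' hpos.ne', Real.log_exp,
    E.γ_add hh, traceInner_add_left, inner_smul_right, inner_sum]
  simp only [inner_centeredStatistic hM, Finset.sum_sub_distrib, Finset.sum_const,
    Finset.card_range, nsmul_eq_mul, mul_sub]
  -- The mean of ⟨C h, T⟩ from the log-integral cancels the centring of the sample mean; for n = 0
  -- the empty sample would have no centring to cancel it.
  have hn' : (n : ℝ) ≠ 0 := Nat.cast_ne_zero.2 hn
  have hg : traceInner (C h) (E.gram fun i : Fin n => x i) =
      (n : ℝ)⁻¹ * ∑ i ∈ Finset.range n, traceInner (C h) (E.T (x i)) := by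
    rw [gram, traceInner_smul_right, traceInner_sum_right,
      Fin.sum_univ_eq_sum_range (fun i => traceInner (C h) (E.T (x i)))]
  rw [hg, inv_mul_cancel_left₀ hn']
  ring

theorem isMLE_add_iff {L : AffineSubspace ℝ (Matrix (Fin q) (Fin q) ℝ)}
    {𝔐 : Set (Matrix (Fin q) (Fin q) ℝ)} (h𝔐 : E.IsParameterSpace L 𝔐) (hM : M ∈ 𝔐)
    [IsProbabilityMeasure (E.law M)] (hsurj : ∀ N ∈ 𝔐, ∃ h, N = M + C h) {n : ℕ} (hn : n ≠ 0)
    (x : ℕ → E.D) (h : EuclideanSpace ℝ (Fin d)) :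
    E.IsMLE 𝔐 (fun i : Fin n => x i) (M + C h) ↔
      h ∈ {h | M + C h ∈ 𝔐} ∧ IsMinOn
        (fun h => inner ℝ h ((n : ℝ)⁻¹ • ∑ i ∈ Finset.range n, E.centeredStatistic M C (x i)) +
          Real.log (∫ y, Real.exp (-inner ℝ h (E.centeredStatistic M C y)) ∂E.law M))
        {h | M + C h ∈ 𝔐} h := by
  have hfin : ∀ N ∈ 𝔐, E.partition N < ∞ := fun N hN =>
    interior_subset (s := {M | E.partition M < ∞}) (h𝔐.subset hN)
  have key := fun h (hh : M + C h ∈ 𝔐) =>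
    traceInner_gram_add_γ (h𝔐.subset hM) (hfin _ hh) hn x
  refine and_congr_right fun hh => ⟨fun hmin h' hh' => ?_, fun hmin N hN => ?_⟩
  · have := hmin hh'
    simp only [Set.mem_ofPred_eq] at this ⊢
    rw [key h hh, key h' hh'] at this
    linarith
  · obtain ⟨h', rfl⟩ := hsurj N hN
    have := hmin hN
    simp only [Set.mem_ofPred_eq] at this ⊢
    rw [key h hh, key h' hN]
    linarith

end Centered

end TraceModel

end ExpTrace

namespace ExpTrace

namespace TraceModel

section Parametrization

variable {p q : ℕ} {E : TraceModel p q} {M : Matrix (Fin q) (Fin q) ℝ} {d : ℕ}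
  {b : Fin d → Matrix (Fin q) (Fin q) ℝ} {B : Matrix (Fin d) (Fin d) ℝ}

/-- Whitening: `B⁻¹` with `J = Bᵀ B` turns the Fisher information into the identity. -/
theorem fisher_parametrization [IsProbabilityMeasure (E.law M)] (hM : M ∈ E.naturalParameters)
    (hB : IsUnit B.det) (hJ : E.fisherMatrix M b = Bᵀ * B) (h : EuclideanSpace ℝ (Fin d)) :
    E.fisher M (parametrization B⁻¹ b h) (parametrization B⁻¹ b h) = ‖h‖ ^ 2 := by
  have hh : B *ᵥ B⁻¹ *ᵥ h.ofLp = h.ofLp := by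
    rw [Matrix.mulVec_mulVec, Matrix.mul_nonsing_inv _ hB, Matrix.one_mulVec]
  rw [parametrization_apply, fisher_sum_sum hM, hJ, ← Matrix.mulVec_mulVec _ Bᵀ B, hh,
    Matrix.dotProduct_mulVec, Matrix.vecMul_transpose, hh, ← real_inner_self_eq_norm_sq, EuclideanSpace.inner_eq_star_dotProduct,
    star_trivial]

/-- A vector h in the kernel has Fisher norm 0, and that norm is ‖h‖. -/
theorem parametrization_injective [IsProbabilityMeasure (E.law M)]
    (hM : M ∈ E.naturalParameters) (hB : IsUnit B.det) (hJ : E.fisherMatrix M b = Bᵀ * B) :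
    Function.Injective (parametrization B⁻¹ b) := by
  rw [injective_iff_map_eq_zero]
  intro h hh
  have h1 := fisher_parametrization hM hB hJ h
  have h2 := fisher_sum_sum hM b 0 0
  simp only [Pi.zero_apply, zero_smul, Finset.sum_const_zero, zero_dotProduct] at h2
  rw [hh, h2] at h1
  simpa using h1.symm

theorem parametrization_mulVec (hB : IsUnit B.det) (v : Fin d → ℝ) :
    parametrization B⁻¹ b (WithLp.toLp 2 (B *ᵥ v)) = ∑ l, v l • b l := by
  rw [parametrization_apply, Matrix.mulVec_mulVec, Matrix.nonsing_inv_mul _ hB,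
    Matrix.one_mulVec]

/-- The matrix with columns `vec (bₗ)`. -/
def vectorMatrix (b : Fin d → Matrix (Fin q) (Fin q) ℝ) : Matrix (Fin q × Fin q) (Fin d) ℝ :=
  Matrix.of fun ij l => b l ij.1 ij.2

/-- J⁻¹ = B⁻¹(B⁻¹)ᵀ, which exhibits the target as the covariance of a linear image of a standard
Gaussian. -/
theorem fisherInverse_eq (hJ : E.fisherMatrix M b = Bᵀ * B) :
    E.fisherInverse M b = vectorMatrix b * B⁻¹ * (vectorMatrix b * B⁻¹)ᵀ := by
  have h1 : vectorMatrix b * B⁻¹ * (vectorMatrix b * B⁻¹)ᵀ =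
      vectorMatrix b * ((E.fisherMatrix M b)⁻¹ * (vectorMatrix b)ᵀ) := by
    rw [hJ, Matrix.mul_inv_rev, Matrix.transpose_mul, Matrix.transpose_nonsing_inv]
    simp only [Matrix.mul_assoc]
  rw [h1]
  ext ij i'j'
  simp only [fisherInverse, vectorMatrix, Matrix.of_apply, Matrix.mul_apply,
    Matrix.transpose_apply, Finset.mul_sum]
  refine Finset.sum_congr rfl fun k _ => Finset.sum_congr rfl fun l _ => ?_
  ring

/-- The vectorized linear map `w ↦ vec (∑ₗ (G w)ₗ bₗ)`. -/
noncomputable def vecParametrization (G : Matrix (Fin d) (Fin d) ℝ)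
    (b : Fin d → Matrix (Fin q) (Fin q) ℝ) :
    EuclideanSpace ℝ (Fin d) →L[ℝ] EuclideanSpace ℝ (Fin q × Fin q) :=
  LinearMap.toContinuousLinearMap
    { toFun := fun w => vectorize (parametrization G b w)
      map_add' := fun v w => by ext; simp [vectorize]
      map_smul' := fun c w => by ext; simp [vectorize] }

theorem vecParametrization_apply (G : Matrix (Fin d) (Fin d) ℝ)
    (b : Fin d → Matrix (Fin q) (Fin q) ℝ) (w : EuclideanSpace ℝ (Fin d)) :
    vecParametrization G b w = vectorize (parametrization G b w) := rfl

theorem ofLp_vecParametrization (G : Matrix (Fin d) (Fin d) ℝ)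
    (b : Fin d → Matrix (Fin q) (Fin q) ℝ) (w : EuclideanSpace ℝ (Fin d)) :
    (vecParametrization G b w).ofLp = (vectorMatrix b * G) *ᵥ w.ofLp := by
  rw [← Matrix.mulVec_mulVec]
  ext ij
  change (∑ l, (G *ᵥ w.ofLp) l • b l) ij.1 ij.2 = ∑ l, b l ij.1 ij.2 * (G *ᵥ w.ofLp) l
  simp only [Matrix.sum_apply, Matrix.smul_apply, smul_eq_mul, mul_comm]

theorem stdGaussian_map_neg_vecParametrization (hJ : E.fisherMatrix M b = Bᵀ * B) :
    (stdGaussian (EuclideanSpace ℝ (Fin d))).map (-vecParametrization B⁻¹ b) =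
      multivariateGaussian 0 (E.fisherInverse M b) := by
  rw [stdGaussian_map_eq_multivariateGaussian (-(vectorMatrix b * B⁻¹)) _ fun w => by
    rw [_root_.neg_apply, WithLp.ofLp_neg, ofLp_vecParametrization,
      Matrix.neg_mulVec], fisherInverse_eq hJ, Matrix.transpose_neg, Matrix.neg_mul,
    Matrix.mul_neg, neg_neg]

end Parametrization

/-- Asymptotics of the maximum likelihood estimator, in coordinates with unit Fisher
information. -/
theorem IsParameterSpace.ae_eventually_mle {p q : ℕ} {E : TraceModel p q}
    {L : AffineSubspace ℝ (Matrix (Fin q) (Fin q) ℝ)}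
    {𝔐 : Set (Matrix (Fin q) (Fin q) ℝ)} (h𝔐 : E.IsParameterSpace L 𝔐)
    {M : Matrix (Fin q) (Fin q) ℝ} (hM : M ∈ 𝔐) [IsProbabilityMeasure (E.law M)]
    {Ω : Type*} [MeasurableSpace Ω] {P : Measure Ω}
    {X : ℕ → Ω → E.D} (hlaw : ∀ i, HasLaw (X i) (E.law M) P) (hindep : iIndepFun X P)
    {d : ℕ} {C : EuclideanSpace ℝ (Fin d) →ₗ[ℝ] Matrix (Fin q) (Fin q) ℝ}
    (hCinj : Function.Injective C) (hCL : ∀ h, C h ∈ L.direction)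
    (hCsurj : ∀ N ∈ 𝔐, ∃ h, N = M + C h) (hCfisher : ∀ h, E.fisher M (C h) (C h) = ‖h‖ ^ 2) :
    MemLp (E.centeredStatistic M C) 2 (E.law M) ∧
    ∀ᵐ ω ∂P, ∀ ρ > 0, ∀ᶠ n : ℕ in atTop,
      (∃! N, E.IsMLE 𝔐 (fun i : Fin n => X i ω) N) ∧
      ∀ N, E.IsMLE 𝔐 (fun i : Fin n => X i ω) N → ∃ h, N = M + C h ∧
        ‖h + (n : ℝ)⁻¹ • ∑ i ∈ Finset.range n, E.centeredStatistic M C (X i ω)‖ ≤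
          ρ * ‖(n : ℝ)⁻¹ • ∑ i ∈ Finset.range n, E.centeredStatistic M C (X i ω)‖ := by
  have hM' := h𝔐.subset hM
  have hfin : ∀ N ∈ 𝔐, E.partition N < ∞ := fun N hN =>
    interior_subset (s := {M | E.partition M < ∞}) (h𝔐.subset hN)
  have hcont : Continuous fun h : EuclideanSpace ℝ (Fin d) => M + C h :=
    continuous_const.add C.continuous_of_finiteDimensional
  -- M + C h never leaves L, so relative openness becomes openness in h.
  have hKo : IsOpen {h | M + C h ∈ 𝔐} := by
    obtain ⟨U, hU, hUL⟩ := h𝔐.relOpen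
    have : {h | M + C h ∈ 𝔐} = (fun h => M + C h) ⁻¹' U := by
      ext h
      have hL : M + C h ∈ L := by
        have := AffineSubspace.vadd_mem_of_mem_direction (hCL h) (hUL ▸ hM).2
        rwa [vadd_eq_add, add_comm] at this
      simp [hUL, hL]
    rw [this]
    exact hU.preimage hcont
  have hKc : Convex ℝ {h | M + C h ∈ 𝔐} :=
    (h𝔐.convex.translate_preimage_right M).linear_preimage C
  have h0 : (0 : EuclideanSpace ℝ (Fin d)) ∈ {h | M + C h ∈ 𝔐} := by simpa using hM
  have hint : ∀ h ∈ {h | M + C h ∈ 𝔐}, Integrable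
      (fun x => Real.exp (-inner ℝ h (E.centeredStatistic M C x))) (E.law M) := by
    intro h hh
    simp only [exp_neg_inner_centeredStatistic hM']
    exact (E.integrable_exp_law (hfin _ hh)).const_mul _
  have hident : ∀ h ∈ {h | M + C h ∈ 𝔐}, ∀ h' ∈ {h | M + C h ∈ 𝔐}, ∀ c,
      (∀ᵐ x ∂E.law M, inner ℝ h (E.centeredStatistic M C x) -
        inner ℝ h' (E.centeredStatistic M C x) = c) → h = h' := by
    intro h hh h' hh' c hc
    refine hCinj (add_left_cancel (a := M) (h𝔐.eq_of_ae_sub_eq_const (M := M) hh hh'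
      (c := c + ∫ y, traceInner (C h) (E.T y) ∂E.law M -
        ∫ y, traceInner (C h') (E.T y) ∂E.law M) ?_))
    filter_upwards [hc] with x hx
    rw [inner_centeredStatistic hM', inner_centeredStatistic hM'] at hx
    rw [traceInner_add_left, traceInner_add_left]
    linarith
  constructor
  · obtain ⟨r, hr, hexp⟩ := integrable_exp_mul_norm measurable_centeredStatistic
      (hKo.mem_nhds h0) hint
    rw [memLp_two_iff_integrable_sq_norm measurable_centeredStatistic.aestronglyMeasurable]
    exact integrable_norm_pow_of_integrable_exp measurable_centeredStatistic hr hexp 2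
  · filter_upwards [ae_eventually_existsUnique_isMinOn_logLikelihood measurable_centeredStatistic
      hKo hKc h0 hint hident (integral_inner_centeredStatistic hM')
      (fun h => (integral_inner_centeredStatistic_sq hM' h).trans (hCfisher h)) hlaw hindep]
      with ω hω ρ hρ
    filter_upwards [hω ρ hρ, eventually_ne_atTop 0] with n hn hn0
    obtain ⟨⟨h, hh, huniq⟩, hbound⟩ := hn _ rfl
    have hiff := isMLE_add_iff h𝔐 hM hCsurj hn0 (fun i => X i ω)
    refine ⟨⟨M + C h, (hiff h).2 hh, fun N hN => ?_⟩, fun N hN => ?_⟩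
    · obtain ⟨h', rfl⟩ := hCsurj N hN.1
      rw [huniq h' ((hiff h').1 hN)]
    · obtain ⟨h', rfl⟩ := hCsurj N hN.1
      have := (hiff h').1 hN
      exact ⟨h', rfl, hbound h' this.1 this.2⟩

end TraceModel

end ExpTrace

/-! ### Main theorem -/

theorem theorem1 {p q : ℕ} (E : ExpTrace.TraceModel p q)
    (L : AffineSubspace ℝ (Matrix (Fin q) (Fin q) ℝ))
    (𝔐 : Set (Matrix (Fin q) (Fin q) ℝ)) (h𝔐 : E.IsParameterSpace L 𝔐)
    -- the true parameter and the i.i.d. observations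
    (M : Matrix (Fin q) (Fin q) ℝ) (hM : M ∈ 𝔐)
    {Ω : Type*} [MeasurableSpace Ω] (P : Measure Ω) [IsProbabilityMeasure P]
    (X : ℕ → Ω → E.D) (hlaw : ∀ i, HasLaw (X i) (E.law M) P) (hindep : iIndepFun X P)
    -- the estimator: measurable, and equal to the minimizer whenever there is one
    (Mhat : ℕ → Ω → Matrix (Fin q) (Fin q) ℝ)
    (hmeas : ∀ n i j, AEMeasurable (fun ω => Mhat n ω i j) P)
    (hmle : ∀ n, ∀ᵐ ω ∂P, (∃ N, E.IsMLE 𝔐 (fun i : Fin n => X i ω) N) →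
      E.IsMLE 𝔐 (fun i : Fin n => X i ω) (Mhat n ω)) :
    -- almost surely, for all large `n`, the minimizer exists and is unique
    (∀ᵐ ω ∂P, ∀ᶠ n : ℕ in atTop, ∃! N, E.IsMLE 𝔐 (fun i : Fin n => X i ω) N) ∧
    -- the Fisher information is positive definite along `𝔐`, and the estimator is
    -- asymptotically normal with covariance the inverse Fisher information
    ∀ (d : ℕ) (b : Module.Basis (Fin d) ℝ L.direction),
      (E.fisherMatrix M (fun k => (b k : Matrix (Fin q) (Fin q) ℝ))).PosDef ∧
      TendstoInDistribution
        (fun (n : ℕ) ω => √(n : ℝ) • ExpTrace.vectorize (Mhat n ω - M)) atTop id (fun _ => P)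
        (multivariateGaussian 0
          (E.fisherInverse M (fun k => (b k : Matrix (Fin q) (Fin q) ℝ)))) := by
  have : IsProbabilityMeasure (E.law M) := by
    rw [← (hlaw 0).map_eq]
    exact Measure.isProbabilityMeasure_map (hlaw 0).aemeasurable
  have hM' := h𝔐.subset hM
  have hsub : ∀ N ∈ 𝔐, N ∈ L := by
    obtain ⟨U, -, rfl⟩ := h𝔐.relOpen
    exact fun N hN => hN.2
  have hmle' := ae_all_iff.2 hmle
  -- The existence claim mentions no basis, but its proof needs coordinates; any basis of the
  -- direction space will do at the end.
  have main : ∀ (d : ℕ) (b : Module.Basis (Fin d) ℝ L.direction),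
      (E.fisherMatrix M (fun k => (b k : Matrix (Fin q) (Fin q) ℝ))).PosDef ∧
      (∀ᵐ ω ∂P, ∀ᶠ n : ℕ in atTop, ∃! N, E.IsMLE 𝔐 (fun i : Fin n => X i ω) N) ∧
      TendstoInDistribution
        (fun (n : ℕ) ω => √(n : ℝ) • ExpTrace.vectorize (Mhat n ω - M)) atTop id (fun _ => P)
        (multivariateGaussian 0
          (E.fisherInverse M (fun k => (b k : Matrix (Fin q) (Fin q) ℝ)))) := by
    intro d b
    have hpd := h𝔐.posDef_fisherMatrix hM b
    obtain ⟨B, hB, hJ⟩ := hpd.exists_transpose_mul_self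
    set b' : Fin d → Matrix (Fin q) (Fin q) ℝ := fun k => b k with hb'
    set C := ExpTrace.TraceModel.parametrization B⁻¹ b' with hC
    set C' := ExpTrace.TraceModel.vecParametrization B⁻¹ b' with hC'
    have hfisher := ExpTrace.TraceModel.fisher_parametrization hM' hB hJ
    have hCL : ∀ h, C h ∈ L.direction := fun h => by
      rw [hC, ExpTrace.TraceModel.parametrization_apply]
      exact Submodule.sum_mem _ fun l _ => L.direction.smul_mem _ (b l).2
    have hCsurj : ∀ N ∈ 𝔐, ∃ h, N = M + C h := by
      intro N hN
      have hdir : N - M ∈ L.direction := AffineSubspace.vsub_mem_direction (hsub N hN) (hsub M hM)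
      refine ⟨WithLp.toLp 2 (B *ᵥ ⇑(b.repr ⟨N - M, hdir⟩)), ?_⟩
      rw [hC, ExpTrace.TraceModel.parametrization_mulVec hB]
      have := congrArg (Subtype.val) (b.sum_repr ⟨N - M, hdir⟩)
      simp only [Submodule.coe_sum, Submodule.coe_smul] at this
      rw [hb', this, add_sub_cancel]
    obtain ⟨hL2, hae⟩ := h𝔐.ae_eventually_mle hM hlaw hindep
      (ExpTrace.TraceModel.parametrization_injective hM' hB hJ) hCL hCsurj hfisher
    refine ⟨hpd, ?_, ?_⟩
    · filter_upwards [hae] with ω hω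
      filter_upwards [hω 1 one_pos] with n hn using hn.1
    · have hclt := tendstoInDistribution_sqrt_smul_mean
        (ExpTrace.TraceModel.measurable_centeredStatistic (E := E) (M := M) (C := C)) hL2
        (ExpTrace.TraceModel.integral_inner_centeredStatistic hM')
        (fun h => (ExpTrace.TraceModel.integral_inner_centeredStatistic_sq hM' h).trans
          (hfisher h)) hlaw hindep
      have hZ : ∀ n : ℕ, AEMeasurable
          (fun ω => √(n : ℝ) • ExpTrace.vectorize (Mhat n ω - M)) P := by
        intro n
        have h1 : AEMeasurable (fun ω (ij : Fin q × Fin q) => (Mhat n ω - M) ij.1 ij.2) P :=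
          aemeasurable_pi_iff.2 fun ij => (hmeas n ij.1 ij.2).sub_const _
        have h2 : AEMeasurable (fun ω => ExpTrace.vectorize (Mhat n ω - M)) P :=
          (WithLp.measurable_toLp 2 _).comp_aemeasurable h1
        exact h2.const_smul (√(n : ℝ))
      have hlim := tendstoInDistribution_neg_clm_of_isLittleO hclt hZ C' (by
        filter_upwards [hae, hmle'] with ω hω hω' ρ hρ
        -- Dividing by ‖C'‖ + 1 pays for the operator norm of C', and is safe when C' = 0.
        filter_upwards [hω (ρ / (‖C'‖ + 1)) (by positivity)] with n hn
        obtain ⟨h, hh, hbound⟩ := hn.2 _ (hω' n hn.1.exists)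
        rw [hh, add_sub_cancel_left]
        rw [hC, ← ExpTrace.TraceModel.vecParametrization_apply, ← hC', ← map_smul, ← map_add,
          ← smul_add]
        refine (C'.le_opNorm _).trans ?_
        rw [norm_smul, norm_smul, Real.norm_of_nonneg (Real.sqrt_nonneg _)]
        have hc : ‖C'‖ * (ρ / (‖C'‖ + 1)) ≤ ρ := by
          rw [mul_div_assoc', div_le_iff₀ (by positivity)]
          nlinarith [norm_nonneg C']
        calc _ ≤ ‖C'‖ * (√(n : ℝ) * (ρ / (‖C'‖ + 1) * ‖(n : ℝ)⁻¹ •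
                ∑ i ∈ Finset.range n, E.centeredStatistic M C (X i ω)‖)) := by gcongr
          _ = ‖C'‖ * (ρ / (‖C'‖ + 1)) * (√(n : ℝ) * ‖(n : ℝ)⁻¹ •
                ∑ i ∈ Finset.range n, E.centeredStatistic M C (X i ω)‖) := by ring
          _ ≤ _ := by gcongr)
      refine ⟨hZ, aemeasurable_id, ?_⟩
      have hmap : (stdGaussian (EuclideanSpace ℝ (Fin d))).map (fun ω => -C' (id ω)) =
          (multivariateGaussian 0 (E.fisherInverse M b')).map id := by
        rw [Measure.map_id]
        exact ExpTrace.TraceModel.stdGaussian_map_neg_vecParametrization hJ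
      have htend := hlim.tendsto
      rw! [hmap] at htend
      exact htend
  exact ⟨(main _ (Module.finBasis ℝ L.direction)).2.1, fun d b =>
    ⟨(main d b).1, (main d b).2.2⟩⟩
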